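/- Let $k$ be an algebraically closed field, let $m\ge 1$ be an integer that is invertible in $k$, let $\xi\in k$ be a primitive $m$-th root of unity, let $n\ge 0$, and let $\delta=(\delta_i)_{i\in\mathbb Z/m\mathbb Z}\in k^m$. **The algebra $B^m_n(\delta)$.** A reduced $(m,n)$-diagram has $n$ northern nodes $1,\dots,n$ and $n$ southern nodes $\bar1,\dots,\bar n$. Every node is joined to exactly one other node by a strand, and every strand is oriented and labelled by an element of $\mathbb Z/m\mathbb Z$; reversing the orientation of a strand and negating its label gives the same diagram. $B^m_n(\delta)$ is the $k$-vector space with basis the reduced $(m,n)$-diagrams, and its bilinear product is as follows. To form $x\cdot y$, place $x$ above $y$, identify the southern nodes of $x$ with the northern nodes of $y$, orient the strands compatibly, and add the labels along each resulting strand. Each closed loop is removed and replaced by the factor $\delta_i$, where $i$ is the label of the loop when it is oriented downwards at its leftmost central node. The unit is the identity diagram. (For arbitrary $\delta$ this product need not be associative; no restriction on $\delta$ is needed below.) The Brauer algebra is $B(N,d)=B^1_N(d)$. The walled Brauer algebra $WB(a,b,d)\subseteq B(a+b,d)$ is the span of the diagrams in which, with a vertical wall after the first $a$ northern and the first $a$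 southern nodes, every arc (a strand joining two northern or two southern nodes) crosses the wall and no other strand does. **The idempotents.** Let $t_i^q$ be the diagram with strands from $l$ to $\bar l$ for all $l$, where the strand from $i$ down to $\bar i$ has label $q$ and all other labels are $0$. Put $T_i^r=\frac1m\sum_{q=1}^{m}\xi^{qr}t_i^q$. Let $\omega=(\omega_0,\dots,\omega_{m-1})$ be an $m$-composition of $n$, that is, a tuple of non-negative integers with sum $n$. Put $\pi_\omega=\prod_{r=0}^{m-1}\prod_{i}T_i^r$, where the inner product is over all $i$ with $\omega_0+\dots+\omega_{r-1}<i\le\omega_0+\dots+\omega_r$. Finally put $\bar\delta_r=\frac1m\sum_{i=0}^{m-1}\xi^{ir}\delta_i$. **Theorem.** The subspace $B^m_\omega=\pi_\omega B^m_n(\delta)\pi_\omega$ contains $\pi_\omega$ and is closed under multiplication. With unit $\pi_\omega$ it is isomorphic as a unital $k$-algebra to $$B(\omega_0,\bar\delta_0)\otimes\bigotimes_{0<r<m/2}WB(\omega_r,\omega_{m-r},\bar\delta_r)$$ if $m$ is odd, and to $$B(\omega_0,\bar\delta_0)\otimes\Bigl(\bigotimes_{0<r<m/2}WB(\omega_r,\omega_{m-r},\bar\delta_r)\Bigr)\otimes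 B(\omega_{m/2},\bar\delta_{m/2})$$ if $m$ is even. Tensor products are over $k$, and an empty tensor product is $k$. -/

import Mathlib

open scoped TensorProduct

set_option linter.unusedSimpArgs false

/-! ### Diagrams -/

/-- The nodes of an `(m,n)`-diagram: `Sum.inl i` is the northern node `i`, and `Sum.inr i` is the
southern node `i` (counted from left to right, starting from `0`). -/
abbrev CBNode (n : ℕ) : Type := Fin n ⊕ Fin n

/-- A reduced `(m,n)`-diagram. Every node is joined to exactly one other node, its `partner`, and
`label v` is the label of the strand through `v` when that strand is oriented away from `v`;
reversing the orientation of a strand negates its label. -/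
@[ext]
structure CBDiagram (m n : ℕ) : Type where
  partner : CBNode n → CBNode n
  label : CBNode n → ZMod m
  partner_partner : ∀ v, partner (partner v) = v
  partner_ne : ∀ v, partner v ≠ v
  label_partner : ∀ v, label (partner v) = -label v

/-- The nodes of the two diagrams of a concatenation `x` above `y`: `Sum.inl v` is the node `v` of
`x` and `Sum.inr v` is the node `v` of `y`. -/
abbrev CBPoint (n : ℕ) : Type := CBNode n ⊕ CBNode n

namespace CBPoint

variable {n : ℕ}

/-- The identification of the southern nodes of the upper diagram with the northern nodes of the
lower one. The nodes on the outer frame are fixed. -/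
def glue : CBPoint n → CBPoint n
  | Sum.inl (Sum.inl i) => Sum.inl (Sum.inl i)
  | Sum.inl (Sum.inr j) => Sum.inr (Sum.inl j)
  | Sum.inr (Sum.inl j) => Sum.inl (Sum.inr j)
  | Sum.inr (Sum.inr i) => Sum.inr (Sum.inr i)

/-- The points on the outer frame: northern nodes of the upper diagram and southern nodes of the
lower diagram. -/
def IsOuter (d : CBPoint n) : Prop := glue d = d

instance (d : CBPoint n) : Decidable (IsOuter d) := inferInstanceAs (Decidable (glue d = d))

/-- A node of the concatenated diagram, as a point on the outer frame. -/
def ofNode : CBNode n → CBPoint n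
  | Sum.inl i => Sum.inl (Sum.inl i)
  | Sum.inr i => Sum.inr (Sum.inr i)

/-- The inverse of `ofNode` on the outer frame (only used there). -/
def toNode : CBPoint n → CBNode n
  | Sum.inl (Sum.inl i) => Sum.inl i
  | Sum.inl (Sum.inr i) => Sum.inr i
  | Sum.inr (Sum.inl i) => Sum.inl i
  | Sum.inr (Sum.inr i) => Sum.inr i

/-- The central node `j`, seen as a northern node of the lower diagram. -/
def central (j : Fin n) : CBPoint n := Sum.inr (Sum.inl j)

theorem glue_glue (d : CBPoint n) : glue (glue d) = d := by
  rcases d with (_ | _) | (_ | _) <;> rfl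

theorem isOuter_ofNode (v : CBNode n) : IsOuter (ofNode v) := by
  rcases v with _ | _ <;> rfl

theorem toNode_ofNode (v : CBNode n) : toNode (ofNode v) = v := by
  rcases v with _ | _ <;> rfl

theorem ofNode_toNode {d : CBPoint n} (h : IsOuter d) : ofNode (toNode d) = d := by
  rcases d with (_ | _) | (_ | _) <;> first | rfl | (simp [IsOuter, glue] at h)

theorem isOuter_glue {d : CBPoint n} : IsOuter (glue d) ↔ IsOuter d := by
  unfold IsOuter
  rw [glue_glue]
  exact eq_comm

end CBPoint

namespace CBDiagram

open CBPoint

variable {m n : ℕ}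

/-- The other end of the strand at a point of the concatenation of `x` above `y`. -/
def across (x y : CBDiagram m n) : CBPoint n → CBPoint n :=
  Sum.map x.partner y.partner

/-- The label of the strand at a point of the concatenation, oriented away from that point. -/
def labelAt (x y : CBDiagram m n) : CBPoint n → ZMod m :=
  Sum.elim x.label y.label

/-- One step along the concatenation of `x` above `y`: traverse the strand that starts at the point,
then, if its other end is a central node, pass through it to the other diagram. -/
def step (x y : CBDiagram m n) (d : CBPoint n) : CBPoint n := glue (across x y d)

theorem across_across (x y : CBDiagram m n) (d : CBPoint n) : across x y (across x y d) = d := by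
  rcases d with d | d <;> simp [across, partner_partner]

theorem across_ne (x y : CBDiagram m n) (d : CBPoint n) : across x y d ≠ d := by
  rcases d with d | d <;> simp [across, partner_ne]

theorem labelAt_across (x y : CBDiagram m n) (d : CBPoint n) :
    labelAt x y (across x y d) = -labelAt x y d := by
  rcases d with d | d <;> simp [across, labelAt, label_partner]

theorem step_injective (x y : CBDiagram m n) : Function.Injective (step x y) := by
  intro d e h
  have h2 := congrArg (fun z => across x y (glue z)) h
  simpa [step, glue_glue, across_across] using h2

theorem exists_return (x y : CBDiagram m n) (v : CBNode n) :
    ∃ j, 0 < j ∧ IsOuter ((step x y)^[j] (ofNode v)) := by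
  have h : ofNode v ∈ Function.periodicPts (step x y) :=
    (step_injective x y).mem_periodicPts _
  refine ⟨Function.minimalPeriod (step x y) (ofNode v), Function.minimalPeriod_pos_of_mem_periodicPts h, ?_⟩
  rw [Function.iterate_minimalPeriod]
  exact isOuter_ofNode v

open Classical in
/-- The number of strands of `x` and `y` which make up the strand of the concatenation that starts
at the node `v` of the outer frame. -/
noncomputable def pathLength (x y : CBDiagram m n) (v : CBNode n) : ℕ :=
  Nat.find (exists_return x y v)

/-- The node of the outer frame that is joined to `v` in the concatenation of `x` above `y`. -/
noncomputable def pathEnd (x y : CBDiagram m n) (v : CBNode n) : CBNode n :=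
  toNode ((step x y)^[pathLength x y v] (ofNode v))

/-- The sum of the labels, compatibly oriented, along the strand of the concatenation that starts
at the node `v` of the outer frame. -/
noncomputable def pathLabel (x y : CBDiagram m n) (v : CBNode n) : ZMod m :=
  ∑ j ∈ Finset.range (pathLength x y v), labelAt x y ((step x y)^[j] (ofNode v))

theorem pathLength_pos (x y : CBDiagram m n) (v : CBNode n) : 0 < pathLength x y v := by
  classical
  exact (Nat.find_spec (exists_return x y v)).1

theorem isOuter_pathLength (x y : CBDiagram m n) (v : CBNode n) :
    IsOuter ((step x y)^[pathLength x y v] (ofNode v)) := by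
  classical
  exact (Nat.find_spec (exists_return x y v)).2

theorem not_isOuter_of_lt {x y : CBDiagram m n} {v : CBNode n} {j : ℕ} (h0 : 0 < j)
    (hj : j < pathLength x y v) : ¬ IsOuter ((step x y)^[j] (ofNode v)) := by
  classical
  exact fun h => Nat.find_min (exists_return x y v) hj ⟨h0, h⟩

theorem pathLength_eq {x y : CBDiagram m n} {v : CBNode n} {k : ℕ} (h0 : 0 < k)
    (hk : IsOuter ((step x y)^[k] (ofNode v)))
    (h : ∀ j, 0 < j → j < k → ¬ IsOuter ((step x y)^[j] (ofNode v))) : pathLength x y v = k := by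
  classical
  refine (Nat.find_eq_iff _).2 ⟨⟨h0, hk⟩, fun j hj hh => h j hh.1 hj hh.2⟩

theorem ofNode_pathEnd (x y : CBDiagram m n) (v : CBNode n) :
    ofNode (pathEnd x y v) = (step x y)^[pathLength x y v] (ofNode v) :=
  ofNode_toNode (isOuter_pathLength x y v)

/-- Walking back along a strand of the concatenation. -/
theorem iterate_pathEnd (x y : CBDiagram m n) (v : CBNode n) {j : ℕ} (hj : j ≤ pathLength x y v) :
    (step x y)^[j] (ofNode (pathEnd x y v)) =
      glue ((step x y)^[pathLength x y v - j] (ofNode v)) := by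
  induction j with
  | zero =>
    rw [ofNode_pathEnd]
    exact (isOuter_pathLength x y v).symm
  | succ j ih =>
    rw [Function.iterate_succ_apply', ih (by omega)]
    obtain ⟨i, hi⟩ : ∃ i, pathLength x y v - j = i + 1 := ⟨pathLength x y v - j - 1, by omega⟩
    have hi' : pathLength x y v - (j + 1) = i := by omega
    rw [hi, hi', Function.iterate_succ_apply']
    simp [step, glue_glue, across_across]

theorem pathLength_pathEnd (x y : CBDiagram m n) (v : CBNode n) :
    pathLength x y (pathEnd x y v) = pathLength x y v := by
  refine pathLength_eq (pathLength_pos x y v) ?_ ?_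
  · rw [iterate_pathEnd x y v le_rfl, isOuter_glue, Nat.sub_self]
    exact isOuter_ofNode v
  · intro j h0 hj
    rw [iterate_pathEnd x y v hj.le, isOuter_glue]
    exact not_isOuter_of_lt (by omega) (by omega)

theorem pathEnd_pathEnd (x y : CBDiagram m n) (v : CBNode n) :
    pathEnd x y (pathEnd x y v) = v := by
  rw [show pathEnd x y (pathEnd x y v) = toNode ((step x y)^[pathLength x y (pathEnd x y v)]
    (ofNode (pathEnd x y v))) from rfl, pathLength_pathEnd, iterate_pathEnd x y v le_rfl, Nat.sub_self]
  change toNode (glue (ofNode v)) = v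
  rw [isOuter_ofNode v, toNode_ofNode]

theorem pathEnd_ne (x y : CBDiagram m n) (v : CBNode n) : pathEnd x y v ≠ v := by
  intro hv
  have hpos := pathLength_pos x y v
  have hb := fun j (hj : j ≤ pathLength x y v) => iterate_pathEnd x y v hj
  rw [hv] at hb
  rcases Nat.even_or_odd' (pathLength x y v) with ⟨h, hh | hh⟩
  · have h1 := hb h (by omega)
    rw [show pathLength x y v - h = h by omega] at h1
    exact not_isOuter_of_lt (by omega) (by omega) h1.symm
  · have h1 := hb (h + 1) (by omega)
    rw [show pathLength x y v - (h + 1) = h by omega, Function.iterate_succ_apply'] at h1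
    have h2 := congrArg glue h1
    simp only [step, glue_glue] at h2
    exact across_ne x y _ h2

theorem pathLabel_pathEnd (x y : CBDiagram m n) (v : CBNode n) :
    pathLabel x y (pathEnd x y v) = -pathLabel x y v := by
  unfold pathLabel
  rw [pathLength_pathEnd, ← Finset.sum_neg_distrib,
    ← Finset.sum_range_reflect (fun j => -labelAt x y ((step x y)^[j] (ofNode v)))]
  refine Finset.sum_congr rfl fun j hj => ?_
  rw [Finset.mem_range] at hj
  rw [iterate_pathEnd x y v hj.le]
  obtain ⟨i, hi⟩ : ∃ i, pathLength x y v - j = i + 1 := ⟨pathLength x y v - j - 1, by omega⟩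
  have hi' : pathLength x y v - 1 - j = i := by omega
  rw [hi, hi', Function.iterate_succ_apply', ← labelAt_across]
  simp [step, glue_glue]

/-- The concatenation of `x` above `y`, with all closed loops removed. -/
noncomputable def concat (x y : CBDiagram m n) : CBDiagram m n where
  partner := pathEnd x y
  label := pathLabel x y
  partner_partner := pathEnd_pathEnd x y
  partner_ne := pathEnd_ne x y
  label_partner := pathLabel_pathEnd x y

/-- The central node `j` lies on a closed loop of the concatenation of `x` above `y`, and is the
leftmost central node of that loop. -/
def IsLoopStart (x y : CBDiagram m n) (j : Fin n) : Prop :=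
  (∀ a : ℕ, ¬ IsOuter ((step x y)^[a] (central j))) ∧
  ∀ (a : ℕ) (i : Fin n), ((step x y)^[a] (central j) = central i ∨
    (step x y)^[a] (central j) = glue (central i)) → j ≤ i

/-- The label of the closed loop through the central node `j`, oriented such that it points
downwards (into `y`) at `j`. -/
noncomputable def loopLabel (x y : CBDiagram m n) (j : Fin n) : ZMod m :=
  ∑ a ∈ Finset.range (Function.minimalPeriod (step x y) (central j)),
    labelAt x y ((step x y)^[a] (central j))

open Classical in
/-- The product of the parameters `δ i`, one for each closed loop of the concatenation of `x` above
`y`, where `i` is the label of the loop, oriented downwards at its leftmost central node. -/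
noncomputable def loopFactor {k : Type*} [CommSemiring k] (δ : ZMod m → k) (x y : CBDiagram m n) :
    k :=
  ∏ j : Fin n, if IsLoopStart x y j then δ (loopLabel x y j) else 1

/-- The diagram `t_1^{q_1} ⋯ t_n^{q_n}`: for every `i` a through strand from the northern node `i` to
the southern node `i` with label `q i` when oriented downwards. -/
def ofLabels (q : Fin n → ZMod m) : CBDiagram m n where
  partner := Sum.swap
  label := Sum.elim q (-q)
  partner_partner := Sum.swap_swap
  partner_ne v := by rcases v with v | v <;> simp
  label_partner v := by rcases v with v | v <;> simp

/-- The identity diagram. -/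
def idDiagram (m n : ℕ) : CBDiagram m n := ofLabels 0

theorem concat_idDiagram_left (d : CBDiagram m n) : concat (idDiagram m n) d = d := by
  have key : ∀ v, pathEnd (idDiagram m n) d v = d.partner v ∧
      pathLabel (idDiagram m n) d v = d.label v := by
    intro v
    rcases v with i | i
    · rcases h : d.partner (Sum.inl i) with j | j
      · have hk : pathLength (idDiagram m n) d (Sum.inl i) = 3 := by
          refine pathLength_eq (by norm_num) ?_ ?_
          · simp [step, across, ofNode, glue, idDiagram, ofLabels, h, IsOuter]
          · intro a h0 ha
            interval_cases a <;>
              simp [step, across, ofNode, glue, idDiagram, ofLabels, h, IsOuter]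
        simp only [pathEnd, pathLabel, hk]
        simp [Finset.sum_range_succ, step, across, ofNode, glue, idDiagram,
          ofLabels, h, toNode, labelAt]
      · have hk : pathLength (idDiagram m n) d (Sum.inl i) = 2 := by
          refine pathLength_eq (by norm_num) ?_ ?_
          · simp [step, across, ofNode, glue, idDiagram, ofLabels, h, IsOuter]
          · intro a h0 ha
            interval_cases a
            simp [step, across, ofNode, glue, idDiagram, ofLabels, IsOuter]
        simp only [pathEnd, pathLabel, hk]
        simp [Finset.sum_range_succ, step, across, ofNode, glue, idDiagram,
          ofLabels, h, toNode, labelAt]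
    · rcases h : d.partner (Sum.inr i) with j | j
      · have hk : pathLength (idDiagram m n) d (Sum.inr i) = 2 := by
          refine pathLength_eq (by norm_num) ?_ ?_
          · simp [step, across, ofNode, glue, idDiagram, ofLabels, h, IsOuter]
          · intro a h0 ha
            interval_cases a
            simp [step, across, ofNode, glue, h, IsOuter]
        simp only [pathEnd, pathLabel, hk]
        simp [Finset.sum_range_succ, step, across, ofNode, glue, idDiagram,
          ofLabels, h, toNode, labelAt]
      · have hk : pathLength (idDiagram m n) d (Sum.inr i) = 1 := by
          refine pathLength_eq (by norm_num) ?_ ?_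
          · simp [step, across, ofNode, glue, h, IsOuter]
          · intro a h0 ha
            omega
        simp only [pathEnd, pathLabel, hk]
        simp [Finset.sum_range_succ, step, across, ofNode, glue, h, toNode, labelAt]
  ext v
  · exact (key v).1
  · exact (key v).2

theorem concat_idDiagram_right (d : CBDiagram m n) : concat d (idDiagram m n) = d := by
  have key : ∀ v, pathEnd d (idDiagram m n) v = d.partner v ∧
      pathLabel d (idDiagram m n) v = d.label v := by
    intro v
    rcases v with i | i
    · rcases h : d.partner (Sum.inl i) with j | j
      · have hk : pathLength d (idDiagram m n) (Sum.inl i) = 1 := by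
          refine pathLength_eq (by norm_num) ?_ ?_
          · simp [step, across, ofNode, glue, h, IsOuter]
          · intro a h0 ha
            omega
        simp only [pathEnd, pathLabel, hk]
        simp [Finset.sum_range_succ, step, across, ofNode, glue, h, toNode, labelAt]
      · have hk : pathLength d (idDiagram m n) (Sum.inl i) = 2 := by
          refine pathLength_eq (by norm_num) ?_ ?_
          · simp [step, across, ofNode, glue, idDiagram, ofLabels, h, IsOuter]
          · intro a h0 ha
            interval_cases a
            simp [step, across, ofNode, glue, h, IsOuter]
        simp only [pathEnd, pathLabel, hk]
        simp [Finset.sum_range_succ, step, across, ofNode, glue, idDiagram,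
          ofLabels, h, toNode, labelAt]
    · rcases h : d.partner (Sum.inr i) with j | j
      · have hk : pathLength d (idDiagram m n) (Sum.inr i) = 2 := by
          refine pathLength_eq (by norm_num) ?_ ?_
          · simp [step, across, ofNode, glue, idDiagram, ofLabels, h, IsOuter]
          · intro a h0 ha
            interval_cases a
            simp [step, across, ofNode, glue, idDiagram, ofLabels, IsOuter]
        simp only [pathEnd, pathLabel, hk]
        simp [Finset.sum_range_succ, step, across, ofNode, glue, idDiagram,
          ofLabels, h, toNode, labelAt]
      · have hk : pathLength d (idDiagram m n) (Sum.inr i) = 3 := by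
          refine pathLength_eq (by norm_num) ?_ ?_
          · simp [step, across, ofNode, glue, idDiagram, ofLabels, h, IsOuter]
          · intro a h0 ha
            interval_cases a <;>
              simp [step, across, ofNode, glue, idDiagram, ofLabels, h, IsOuter]
        simp only [pathEnd, pathLabel, hk]
        simp [Finset.sum_range_succ, step, across, ofNode, glue, idDiagram,
          ofLabels, h, toNode, labelAt]
  ext v
  · exact (key v).1
  · exact (key v).2

theorem loopFactor_idDiagram_left {k : Type*} [CommSemiring k] (δ : ZMod m → k)
    (d : CBDiagram m n) : loopFactor δ (idDiagram m n) d = 1 := by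
  unfold loopFactor
  refine Finset.prod_eq_one fun j _ => if_neg fun hj => ?_
  rcases h : d.partner (Sum.inl j) with i | i
  · exact hj.1 2 (by simp [step, across, central, glue, idDiagram, ofLabels, h, IsOuter])
  · exact hj.1 1 (by simp [step, across, central, glue, h, IsOuter])

theorem loopFactor_idDiagram_right {k : Type*} [CommSemiring k] (δ : ZMod m → k)
    (d : CBDiagram m n) : loopFactor δ d (idDiagram m n) = 1 := by
  unfold loopFactor
  refine Finset.prod_eq_one fun j _ => if_neg fun hj => ?_
  exact hj.1 1 (by simp [step, across, central, glue, idDiagram, ofLabels, IsOuter])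

end CBDiagram

/-! ### The cyclotomic Brauer algebra -/

/-- The cyclotomic Brauer algebra `B_n^m(δ)`: the `k`-span of all reduced `(m,n)`-diagrams. -/
def CyclotomicBrauer (k : Type*) [CommRing k] (m n : ℕ) (_δ : ZMod m → k) : Type _ :=
  CBDiagram m n →₀ k

namespace CyclotomicBrauer

variable {k : Type*} [CommRing k] {m n : ℕ} {δ : ZMod m → k}

noncomputable instance : AddCommGroup (CyclotomicBrauer k m n δ) :=
  inferInstanceAs (AddCommGroup (CBDiagram m n →₀ k))

noncomputable instance : Module k (CyclotomicBrauer k m n δ) :=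
  inferInstanceAs (Module k (CBDiagram m n →₀ k))

/-- A diagram as an element of the algebra. -/
noncomputable def of (d : CBDiagram m n) : CyclotomicBrauer k m n δ :=
  Finsupp.single d (1 : k)

/-- The diagrams form a basis. -/
noncomputable def basis (k : Type*) [CommRing k] (m n : ℕ) (δ : ZMod m → k) :
    Module.Basis (CBDiagram m n) k (CyclotomicBrauer k m n δ) :=
  Module.Basis.ofRepr (LinearEquiv.refl k (CBDiagram m n →₀ k))

theorem basis_apply (d : CBDiagram m n) : basis k m n δ d = of d := rfl

/-- The bilinear extension of the concatenation of diagrams. -/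
noncomputable def mulHom (k : Type*) [CommRing k] (m n : ℕ) (δ : ZMod m → k) :
    CyclotomicBrauer k m n δ →ₗ[k] CyclotomicBrauer k m n δ →ₗ[k] CyclotomicBrauer k m n δ :=
  (basis k m n δ).constr k fun x => (basis k m n δ).constr k fun y =>
    CBDiagram.loopFactor δ x y • of (x.concat y)

noncomputable instance : Mul (CyclotomicBrauer k m n δ) := ⟨fun a b => mulHom k m n δ a b⟩

noncomputable instance : One (CyclotomicBrauer k m n δ) := ⟨of (CBDiagram.idDiagram m n)⟩

theorem mul_def (a b : CyclotomicBrauer k m n δ) : a * b = mulHom k m n δ a b := rfl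

theorem of_mul_of (x y : CBDiagram m n) :
    (of x * of y : CyclotomicBrauer k m n δ) =
      CBDiagram.loopFactor δ x y • of (x.concat y) := by
  rw [mul_def, mulHom, ← basis_apply, ← basis_apply, Module.Basis.constr_basis,
    Module.Basis.constr_basis]

theorem one_def : (1 : CyclotomicBrauer k m n δ) = of (CBDiagram.idDiagram m n) := rfl

noncomputable instance : NonAssocRing (CyclotomicBrauer k m n δ) where
  left_distrib a b c := by simp only [mul_def, map_add]
  right_distrib a b c := by simp only [mul_def, map_add, LinearMap.add_apply]
  zero_mul a := by simp only [mul_def, map_zero, LinearMap.zero_apply]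
  mul_zero a := by simp only [mul_def, map_zero]
  one_mul a := by
    have h : mulHom k m n δ 1 = LinearMap.id := by
      refine (basis k m n δ).ext fun d => ?_
      rw [← mul_def, basis_apply, one_def, of_mul_of, CBDiagram.loopFactor_idDiagram_left,
        CBDiagram.concat_idDiagram_left, one_smul, LinearMap.id_apply]
    rw [mul_def, h, LinearMap.id_apply]
  mul_one a := by
    have h : (mulHom k m n δ).flip 1 = LinearMap.id := by
      refine (basis k m n δ).ext fun d => ?_
      rw [LinearMap.flip_apply, ← mul_def, basis_apply, one_def, of_mul_of,
        CBDiagram.loopFactor_idDiagram_right, CBDiagram.concat_idDiagram_right, one_smul,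
        LinearMap.id_apply]
    rw [mul_def, ← LinearMap.flip_apply, h, LinearMap.id_apply]

instance : IsScalarTower k (CyclotomicBrauer k m n δ) (CyclotomicBrauer k m n δ) :=
  ⟨fun c a b => by simp only [smul_eq_mul, mul_def, map_smul, LinearMap.smul_apply]⟩

instance : SMulCommClass k (CyclotomicBrauer k m n δ) (CyclotomicBrauer k m n δ) :=
  ⟨fun c a b => by simp only [smul_eq_mul, mul_def, map_smul]⟩

end CyclotomicBrauer

/-! ### Brauer and walled Brauer algebras -/

/-- The classical Brauer algebra `B(n,δ)`. -/
abbrev BrauerAlgebra (k : Type*) [CommRing k] (n : ℕ) (δ : k) : Type _ :=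
  CyclotomicBrauer k 1 n fun _ => δ

namespace CBDiagram

/-- Walled Brauer diagrams, with a vertical wall after the first `r` northern and the first `r`
southern nodes: arcs cross the wall, and through strands do not. -/
def IsWalled {m r s : ℕ} (d : CBDiagram m (r + s)) : Prop :=
  (∀ i j, d.partner (Sum.inl i) = Sum.inl j → ((i : ℕ) < r ↔ ¬ (j : ℕ) < r)) ∧
  (∀ i j, d.partner (Sum.inr i) = Sum.inr j → ((i : ℕ) < r ↔ ¬ (j : ℕ) < r)) ∧
  (∀ i j, d.partner (Sum.inl i) = Sum.inr j → ((i : ℕ) < r ↔ (j : ℕ) < r))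

/-- Northern nodes on the left and southern nodes on the right of the wall. -/
def wallSide (r : ℕ) {n : ℕ} : CBNode n → Prop
  | Sum.inl i => (i : ℕ) < r
  | Sum.inr i => ¬ (i : ℕ) < r

theorem isWalled_iff {m r s : ℕ} (d : CBDiagram m (r + s)) :
    d.IsWalled ↔ ∀ v, (wallSide r (d.partner v) ↔ ¬ wallSide r v) := by
  constructor
  · rintro ⟨h1, h2, h3⟩ (i | i)
    · rcases h : d.partner (Sum.inl i) with j | j
      · have := h1 i j h
        simp only [wallSide]; tauto
      · have := h3 i j h
        simp only [wallSide]; tauto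
    · rcases h : d.partner (Sum.inr i) with j | j
      · have h' : d.partner (Sum.inl j) = Sum.inr i := by rw [← h, d.partner_partner]
        have := h3 j i h'
        simp only [wallSide]; tauto
      · have := h2 i j h
        simp only [wallSide]; tauto
  · intro h
    refine ⟨fun i j hij => ?_, fun i j hij => ?_, fun i j hij => ?_⟩
    · have := h (Sum.inl i)
      rw [hij] at this
      simp only [wallSide] at this; tauto
    · have := h (Sum.inr i)
      rw [hij] at this
      simp only [wallSide] at this; tauto
    · have := h (Sum.inl i)
      rw [hij] at this
      simp only [wallSide] at this; tauto

theorem IsWalled.idDiagram (m r s : ℕ) : (idDiagram m (r + s)).IsWalled := by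
  rw [isWalled_iff]
  rintro (i | i) <;> simp [CBDiagram.idDiagram, ofLabels, wallSide]

theorem IsWalled.concat {m r s : ℕ} {x y : CBDiagram m (r + s)} (hx : x.IsWalled)
    (hy : y.IsWalled) : (x.concat y).IsWalled := by
  rw [isWalled_iff] at hx hy ⊢
  intro v
  let side : CBPoint (r + s) → Prop := Sum.elim (wallSide r) (wallSide r)
  have hacross : ∀ d, (side (across x y d) ↔ ¬ side d) := by
    rintro (d | d)
    · exact hx d
    · exact hy d
  have hglue : ∀ d, ¬ CBPoint.IsOuter d → (side (CBPoint.glue d) ↔ ¬ side d) := by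
    rintro ((d | d) | (d | d)) hd
    · exact absurd rfl hd
    · simp [side, CBPoint.glue, wallSide]
    · simp [side, CBPoint.glue, wallSide]
    · exact absurd rfl hd
  have hside : ∀ v, side (CBPoint.ofNode v) ↔ wallSide r v := by
    rintro (v | v) <;> rfl
  have hstep : ∀ j, j < pathLength x y v →
      (side ((step x y)^[j] (CBPoint.ofNode v)) ↔ wallSide r v) := by
    intro j
    induction j with
    | zero => intro _; exact hside v
    | succ j ih =>
      intro hj
      have ho := not_isOuter_of_lt (Nat.succ_pos j) hj
      have ih' := ih (by omega)
      rw [Function.iterate_succ_apply'] at ho ⊢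
      have h1 := hacross ((step x y)^[j] (CBPoint.ofNode v))
      have h2 := hglue _ (fun h => ho (CBPoint.isOuter_glue.2 h))
      unfold step at h1 h2 ih' ⊢
      tauto
  obtain ⟨i, hi⟩ : ∃ i, pathLength x y v = i + 1 :=
    ⟨pathLength x y v - 1, by have := pathLength_pos x y v; omega⟩
  have hlast := isOuter_pathLength x y v
  have hi' := hstep i (by omega)
  have hend : side (CBPoint.ofNode (pathEnd x y v)) ↔ ¬ wallSide r v := by
    rw [ofNode_pathEnd]
    rw [hi, Function.iterate_succ_apply'] at hlast ⊢
    have h1 := hacross ((step x y)^[i] (CBPoint.ofNode v))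
    have h2 : CBPoint.glue (across x y ((step x y)^[i] (CBPoint.ofNode v))) =
        across x y ((step x y)^[i] (CBPoint.ofNode v)) := CBPoint.isOuter_glue.1 hlast
    change side (CBPoint.glue (across x y ((step x y)^[i] (CBPoint.ofNode v)))) ↔ _
    rw [h2]
    tauto
  rw [hside] at hend
  exact hend

end CBDiagram

/-- The walled Brauer algebra `WB(r,s,δ)`: the subalgebra of `B(r+s,δ)` spanned by the walled Brauer
diagrams. -/
noncomputable def walledBrauerSubalgebra (k : Type*) [CommRing k] (r s : ℕ) (δ : k) :
    NonUnitalSubalgebra k (BrauerAlgebra k (r + s) δ) where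
  __ := Submodule.span k {a | ∃ d : CBDiagram 1 (r + s), d.IsWalled ∧ a = CyclotomicBrauer.of d}
  mul_mem' := by
    intro a b ha hb
    change a ∈ Submodule.span k _ at ha
    change b ∈ Submodule.span k _ at hb
    change a * b ∈ Submodule.span k _
    induction ha, hb using Submodule.span_induction₂ with
    | mem_mem a b ha hb =>
      obtain ⟨x, hx, rfl⟩ := ha
      obtain ⟨y, hy, rfl⟩ := hb
      rw [CyclotomicBrauer.of_mul_of]
      exact Submodule.smul_mem _ _ (Submodule.subset_span ⟨_, hx.concat hy, rfl⟩)
    | zero_left b _ => rw [zero_mul]; exact zero_mem _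
    | zero_right a _ => rw [mul_zero]; exact zero_mem _
    | add_left a b c _ _ _ h1 h2 => rw [add_mul]; exact add_mem h1 h2
    | add_right a b c _ _ _ h1 h2 => rw [mul_add]; exact add_mem h1 h2
    | smul_left c a b _ _ h => rw [smul_mul_assoc]; exact Submodule.smul_mem _ _ h
    | smul_right c a b _ _ h => rw [mul_smul_comm]; exact Submodule.smul_mem _ _ h

/-- The underlying type of the walled Brauer algebra `WB(r,s,δ)`. -/
abbrev WalledBrauerAlgebra (k : Type*) [CommRing k] (r s : ℕ) (δ : k) : Type _ :=
  walledBrauerSubalgebra k r s δ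

theorem one_mem_walledBrauerSubalgebra (k : Type*) [CommRing k] (r s : ℕ) (δ : k) :
    (1 : BrauerAlgebra k (r + s) δ) ∈ walledBrauerSubalgebra k r s δ := by
  change _ ∈ Submodule.span k _
  exact Submodule.subset_span ⟨_, CBDiagram.IsWalled.idDiagram 1 r s, rfl⟩

noncomputable instance WalledBrauerAlgebra.instNonAssocRing (k : Type*) [CommRing k] (r s : ℕ)
    (δ : k) : NonAssocRing (WalledBrauerAlgebra k r s δ) where
  __ := NonUnitalSubalgebra.toNonUnitalNonAssocRing (walledBrauerSubalgebra k r s δ)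
  one := ⟨1, one_mem_walledBrauerSubalgebra k r s δ⟩
  one_mul a := Subtype.ext (one_mul (a : BrauerAlgebra k (r + s) δ))
  mul_one a := Subtype.ext (mul_one (a : BrauerAlgebra k (r + s) δ))

/-! ### Tensor products of finite families of algebras -/

/-- The tensor product of a family of (not necessarily associative) algebras. The underlying module
is `PiTensorProduct k A`, with its factorwise multiplication and the unit `⨂ 1`. -/
def FamilyTensor (k : Type*) [CommRing k] {ι : Type*} (A : ι → Type*)
    [∀ i, NonAssocRing (A i)] [∀ i, Module k (A i)] : Type _ :=
  PiTensorProduct k A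

namespace FamilyTensor

variable {k : Type*} [CommRing k] {ι : Type*} {A : ι → Type*}
  [∀ i, NonAssocRing (A i)] [∀ i, Module k (A i)]
  [∀ i, SMulCommClass k (A i) (A i)] [∀ i, IsScalarTower k (A i) (A i)]

noncomputable instance : NonAssocSemiring (FamilyTensor k A) :=
  inferInstanceAs (NonAssocSemiring (PiTensorProduct k A))

noncomputable instance : Module k (FamilyTensor k A) :=
  inferInstanceAs (Module k (PiTensorProduct k A))

instance : IsScalarTower k (FamilyTensor k A) (FamilyTensor k A) :=
  ⟨fun c a b => LinearMap.congr_fun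
    (LinearMap.map_smul (PiTensorProduct.mul (R := k) (A := A)) c a) b⟩

instance : SMulCommClass k (FamilyTensor k A) (FamilyTensor k A) :=
  ⟨fun c a b => (LinearMap.map_smul (PiTensorProduct.mul (R := k) (A := A) a) c b).symm⟩

end FamilyTensor

/-! ### The idempotents and the idempotent subalgebras -/

/-- The signed cyclotomic parameter `(1/m) ∑_i ξ^{ir} δ_i`. -/
noncomputable def signedParameter {k : Type*} [Field k] {m : ℕ} [NeZero m] (ξ : k)
    (δ : ZMod m → k) (r : ℕ) : k :=
  (m : k)⁻¹ * ∑ i : ZMod m, ξ ^ (i.val * r) * δ i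

namespace CyclotomicBrauer

variable {k : Type*} [Field k] {m n : ℕ}

/-- The diagram `t_i^q`. -/
noncomputable def t (δ : ZMod m → k) (i : Fin n) (q : ZMod m) : CyclotomicBrauer k m n δ :=
  of (CBDiagram.ofLabels (Pi.single i q))

/-- The idempotent `T_i^r = (1/m) ∑_{1 ≤ q ≤ m} ξ^{qr} t_i^q`. -/
noncomputable def T (ξ : k) (δ : ZMod m → k) (i : Fin n) (r : ℕ) : CyclotomicBrauer k m n δ :=
  (m : k)⁻¹ • ∑ q ∈ Finset.Icc 1 m, ξ ^ (q * r) • t δ i (q : ZMod m)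

/-- The `i`-th node (counted from `0`) is in the `r`-th block of the composition `ω`, that is
`ω_0 + ⋯ + ω_{r-1} < i + 1 ≤ ω_0 + ⋯ + ω_r`. -/
def InBlock (ω : Fin m → ℕ) (r : Fin m) (i : Fin n) : Prop :=
  ∑ s ∈ Finset.Iio r, ω s < (i : ℕ) + 1 ∧ (i : ℕ) + 1 ≤ ∑ s ∈ Finset.Iic r, ω s

instance (ω : Fin m → ℕ) (r : Fin m) (i : Fin n) : Decidable (InBlock ω r i) :=
  inferInstanceAs (Decidable (_ ∧ _))

/-- The idempotent `π_ω = ∏_{r=0}^{m-1} ∏_{i ∈ [ω_r]} T_i^r`. -/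
noncomputable def piIdem (ξ : k) (δ : ZMod m → k) (ω : Fin m → ℕ) : CyclotomicBrauer k m n δ :=
  ((List.finRange m).map fun r =>
    (((List.finRange n).filter fun i => InBlock ω r i).map fun i => T ξ δ i (r : ℕ)).prod).prod

end CyclotomicBrauer

/-- The subspace `e A e` of an algebra `A`. -/
def idempotentCorner (k : Type*) {A : Type*} [CommRing k] [NonAssocRing A] [Module k A]
    [IsScalarTower k A A] [SMulCommClass k A A] (e : A) : Submodule k A :=
  LinearMap.range (LinearMap.mulRight k e ∘ₗ LinearMap.mulLeft k e)

/-- `e A e` is closed under the multiplication of `A`, contains `e`, and with this multiplication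
and the unit element `e` it is isomorphic to the unital `k`-algebra `C`. -/
def CornerIsomorphic (k : Type*) {A : Type*} [CommRing k] [NonAssocRing A] [Module k A]
    [IsScalarTower k A A] [SMulCommClass k A A] (e : A)
    (C : Type*) [NonAssocSemiring C] [Module k C] : Prop :=
  ∃ φ : idempotentCorner k e ≃ₗ[k] C,
    (∃ he : e ∈ idempotentCorner k e, φ ⟨e, he⟩ = 1) ∧
    ∀ x y : idempotentCorner k e, ∃ hxy : (x * y : A) ∈ idempotentCorner k e,
      φ ⟨x * y, hxy⟩ = φ x * φ y

/-- The tensor product of the algebras `WB(ω_r, ω_{m-r}, δ̄_r)` over all `r` with `0 < r < m/2`. -/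
abbrev WalledBrauerTensor {k : Type*} [Field k] {m : ℕ} [NeZero m] (ξ : k) (δ : ZMod m → k)
    (ω : Fin m → ℕ) : Type _ :=
  FamilyTensor k fun r : {r : Fin m // 0 < (r : ℕ) ∧ 2 * (r : ℕ) < m} =>
    WalledBrauerAlgebra k (ω r.1) (ω ⟨m - (r.1 : ℕ), Nat.sub_lt (NeZero.pos m) r.2.1⟩)
      (signedParameter ξ δ (r.1 : ℕ))

/-!
For weights `w i`, the block of the node `i` as a residue modulo `m`, the idempotent `π` is the sum
of the labelled identity diagrams, weighted by a character (`piIdem_eq_partialIdem`). Hence `π d π`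
is an average of `d` over all changes of labels by the differences of a function on the nodes
(`average`). Such a change of labels multiplies `π d π` by the value of a character, and so `π d π`
vanishes unless `d` is *balanced*: a through strand joins nodes of the same block, and an arc joins
nodes of blocks `r` and `-r`. Up to scalars `π d π` depends only on the strands of `d`, not on the
labels, and the averages of the balanced unlabelled diagrams are a basis of `π B π`
(`exists_basis_corner`).

The product of two such averages is `average_mul_average`. Only the sums `D` of the labels at the
central nodes matter. The weight is constant along a strand of the concatenation of balanced
diagrams, so that the factor `∏ i, ψ (w i * D i)` splits into contributions of the strands with ends
on the outer frame and of the closed loops (`sum_weight_mul`). The former are absorbed into the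
average of the concatenation. The labels of the closed loops are independent and uniformly
distributed (`sum_prod_loopSum`), and therefore each closed loop contributes the Fourier coefficient
of `δ` at the weight of its leftmost central node. This is a direct computation with diagrams, which
does not need associativity.

A balanced diagram is assembled from its restrictions to the unions of the blocks `r` and `-r`.
The embeddings of these unions are increasing, hence concatenation and leftmost nodes of closed
loops are compatible with assembling (`concat_assemble`, `isLoopStart_assemble`). On the blocks
`0` and `m / 2` every diagram is balanced; on a pair of different blocks balanced means walled
(`isBalanced_iff_isWalled`), and the leftmost node of a closed loop lies on the left of the wall
(`IsLoopStart.weight_eq`). So `π B π` has a basis of families of (walled) Brauer diagrams with the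
structure constants of the tensor product.
-/

/-! ### Orbits of a concatenation -/

namespace CBPoint

variable {n : ℕ}

/-- The function on the points of a concatenation that is `f i` where the central node `i` is passed
downwards, and zero elsewhere. -/
def downward {M : Type*} [Zero M] (f : Fin n → M) : CBPoint n → M
  | Sum.inr (Sum.inl i) => f i
  | _ => 0

/-- The function on the points of a concatenation that is `f i` where the central node `i` is passed
downwards, `-f i` where it is passed upwards, and zero on the outer frame. -/
def crossing {M : Type*} [AddGroup M] (f : Fin n → M) (d : CBPoint n) : M :=
  downward f d - downward f (glue d)

/-- The position, from the left, of a point. -/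
def index : CBPoint n → Fin n :=
  Sum.elim (Sum.elim id id) (Sum.elim id id)

theorem downward_of_isOuter {M : Type*} [Zero M] (f : Fin n → M) {d : CBPoint n}
    (h : IsOuter d) : downward f d = 0 := by
  rcases d with (_ | _) | (_ | _) <;> first | rfl | simp [IsOuter, glue] at h

theorem eq_central_or_of_not_isOuter {d : CBPoint n} (h : ¬ IsOuter d) :
    d = central (index d) ∨ d = glue (central (index d)) := by
  rcases d with (_ | _) | (_ | _)
  · exact absurd rfl h
  · exact Or.inr rfl
  · exact Or.inl rfl
  · exact absurd rfl h

theorem index_glue (d : CBPoint n) : index (glue d) = index d := by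
  rcases d with (_ | _) | (_ | _) <;> rfl

theorem eq_or_eq_glue_of_index_eq {d e : CBPoint n} (hd : ¬ IsOuter d) (he : ¬ IsOuter e)
    (h : index d = index e) : d = e ∨ d = glue e := by
  have h1 := eq_central_or_of_not_isOuter hd
  have h2 := eq_central_or_of_not_isOuter he
  rw [h] at h1
  generalize index e = i at h1 h2
  rcases h1 with rfl | rfl <;> rcases h2 with rfl | rfl <;> simp [glue_glue]

theorem exists_eq_ofNode {d : CBPoint n} (h : IsOuter d) : ∃ v, d = ofNode v :=
  ⟨toNode d, (ofNode_toNode h).symm⟩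

end CBPoint

namespace CBDiagram

open CBPoint

variable {m n : ℕ}

/-- Walking along the concatenation of `x` above `y` leads from one point to the other. -/
def Leads (x y : CBDiagram m n) (d e : CBPoint n) : Prop := ∃ a, (step x y)^[a] d = e

/-- The strand of the concatenation through the point has ends on the outer frame, that is, it is
not a closed loop. -/
def Reaches (x y : CBDiagram m n) (d : CBPoint n) : Prop := ∃ a, IsOuter ((step x y)^[a] d)

theorem Leads.trans {x y : CBDiagram m n} {d e f : CBPoint n} (h : Leads x y d e)
    (h' : Leads x y e f) : Leads x y d f := by
  obtain ⟨a, rfl⟩ := h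
  obtain ⟨b, rfl⟩ := h'
  exact ⟨b + a, Function.iterate_add_apply _ _ _ _⟩

theorem Leads.symm {x y : CBDiagram m n} {d e : CBPoint n} (h : Leads x y d e) :
    Leads x y e d := by
  obtain ⟨a, rfl⟩ := h
  set p := Function.minimalPeriod (step x y) d with hp
  have hpos : 0 < p :=
    Function.minimalPeriod_pos_of_mem_periodicPts ((step_injective x y).mem_periodicPts _)
  refine ⟨p * a - a, ?_⟩
  rw [← Function.iterate_add_apply, Nat.sub_add_cancel (Nat.le_mul_of_pos_left _ hpos)]
  exact ((Function.isPeriodicPt_minimalPeriod (step x y) d).mul_const a)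

/-- Turning around and walking back the same number of steps. -/
theorem iterate_glue_iterate (x y : CBDiagram m n) (d : CBPoint n) (a : ℕ) :
    (step x y)^[a] (glue ((step x y)^[a] d)) = glue d := by
  induction a with
  | zero => rfl
  | succ a ih =>
    rw [Function.iterate_succ_apply, Function.iterate_succ_apply']
    simpa [step, glue_glue, across_across] using ih

theorem Leads.glue {x y : CBDiagram m n} {d e : CBPoint n} (h : Leads x y d e) :
    Leads x y (glue d) (glue e) := by
  obtain ⟨a, rfl⟩ := h
  exact Leads.symm ⟨a, iterate_glue_iterate x y d a⟩

theorem Reaches.of_leads {x y : CBDiagram m n} {d e : CBPoint n} (h : Leads x y d e)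
    (hd : Reaches x y d) : Reaches x y e := by
  obtain ⟨a, ha⟩ := hd
  obtain ⟨b, hb⟩ := h.symm.trans ⟨a, rfl⟩
  exact ⟨b, hb ▸ ha⟩

theorem Reaches.glue {x y : CBDiagram m n} {d : CBPoint n} (hd : Reaches x y d) :
    Reaches x y (glue d) := by
  obtain ⟨a, ha⟩ := hd
  obtain ⟨b, hb⟩ := Leads.glue (x := x) (y := y) ⟨a, rfl⟩
  refine ⟨b, ?_⟩
  rw [hb, isOuter_glue]
  exact ha

/-- A closed loop never runs through the same central node in both directions. -/
theorem not_leads_glue {x y : CBDiagram m n} {d : CBPoint n} (hd : ¬ Reaches x y d) :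
    ¬ Leads x y d (CBPoint.glue d) := by
  rintro ⟨a, ha⟩
  induction a using Nat.strong_induction_on generalizing d with
  | _ a ih =>
    match a, ha with
    | 0, ha => exact hd ⟨0, ha.symm⟩
    | 1, ha =>
      have := congrArg CBPoint.glue ha
      simp only [Function.iterate_one, step, glue_glue] at this
      exact across_ne x y d this
    | b + 2, ha =>
      refine ih b (by omega) (d := step x y d) (fun h => hd (h.of_leads (Leads.symm ⟨1, rfl⟩))) ?_
      rw [Function.iterate_succ_apply', Function.iterate_succ_apply] at ha
      have := congrArg (fun z => across x y (CBPoint.glue z)) ha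
      simpa [step, glue_glue, across_across] using this

/-- A point that is not on a closed loop lies on a strand that starts at a node of the outer frame,
in the given direction. -/
theorem exists_iterate_eq {x y : CBDiagram m n} {d : CBPoint n} (hd : Reaches x y d) :
    ∃ v a, a < pathLength x y v ∧ (step x y)^[a] (ofNode v) = d := by
  classical
  have hex : ∃ a, ∃ v, (step x y)^[a] (ofNode v) = d := by
    obtain ⟨a, ha⟩ := hd
    obtain ⟨v, hv⟩ := exists_eq_ofNode ha
    obtain ⟨b, hb⟩ := Leads.symm (x := x) (y := y) ⟨a, hv⟩
    exact ⟨b, v, hb⟩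
  obtain ⟨v, hv⟩ := Nat.find_spec hex
  refine ⟨v, Nat.find hex, ?_, hv⟩
  by_contra hlt
  push Not at hlt
  have hpos := pathLength_pos x y v
  refine Nat.find_min hex (m := Nat.find hex - pathLength x y v) (by omega)
    ⟨pathEnd x y v, ?_⟩
  rw [ofNode_pathEnd, ← Function.iterate_add_apply, Nat.sub_add_cancel hlt]
  exact hv

theorem iterate_ofNode_injective {x y : CBDiagram m n} {v v' : CBNode n} {a a' : ℕ}
    (ha : a < pathLength x y v) (ha' : a' < pathLength x y v')
    (h : (step x y)^[a] (ofNode v) = (step x y)^[a'] (ofNode v')) : v = v' ∧ a = a' := by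
  wlog hle : a ≤ a' generalizing a a' v v'
  · exact (this ha' ha h.symm (by omega)).imp Eq.symm Eq.symm
  obtain ⟨b, rfl⟩ := Nat.exists_eq_add_of_le hle
  rw [Function.iterate_add_apply] at h
  have h1 := (step_injective x y).iterate a h
  rcases Nat.eq_zero_or_pos b with rfl | hb
  · refine ⟨?_, rfl⟩
    rw [← toNode_ofNode v, h1]
    exact toNode_ofNode v'
  · exact absurd (h1 ▸ isOuter_ofNode v) (not_isOuter_of_lt hb (by omega))

open Classical in
/-- The strands with ends on the outer frame pass, in one direction or the other, exactly once
through each central node that is not on a closed loop. -/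
theorem sum_paths_downward {M : Type*} [AddCommMonoid M] (x y : CBDiagram m n) (f : Fin n → M) :
    ∑ v, ∑ a ∈ Finset.range (pathLength x y v), downward f ((step x y)^[a] (ofNode v)) =
      ∑ i, if Reaches x y (central i) then f i else 0 := by
  have h1 : ∑ v, ∑ a ∈ Finset.range (pathLength x y v), downward f ((step x y)^[a] (ofNode v)) =
      ∑ d with Reaches x y d, downward f d := by
    rw [Finset.sum_sigma']
    refine Finset.sum_bij (fun p _ => (step x y)^[p.2] (ofNode p.1)) ?_ ?_ ?_ ?_
    · rintro ⟨v, a⟩ -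
      simp only [Finset.mem_filter, Finset.mem_univ, true_and]
      exact Reaches.of_leads ⟨a, rfl⟩ ⟨0, isOuter_ofNode v⟩
    · rintro ⟨v, a⟩ ha ⟨v', a'⟩ ha' h
      simp only [Finset.mem_sigma, Finset.mem_univ, true_and, Finset.mem_range] at ha ha'
      obtain ⟨rfl, rfl⟩ := iterate_ofNode_injective ha ha' h
      rfl
    · intro d hd
      simp only [Finset.mem_filter, Finset.mem_univ, true_and] at hd
      obtain ⟨v, a, ha, h⟩ := exists_iterate_eq hd
      exact ⟨⟨v, a⟩, by simpa using ha, h⟩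
    · intros; rfl
  rw [h1, Finset.sum_filter]
  simp only [Fintype.sum_sum_type]
  simp only [downward, central, ite_self, Finset.sum_const_zero, zero_add, add_zero]
  refine Finset.sum_congr rfl fun i _ => ?_
  by_cases h : Reaches x y (Sum.inr (Sum.inl i)) <;> simp only [h, if_true, if_false]

theorem minimalPeriod_step_pos (x y : CBDiagram m n) (d : CBPoint n) :
    0 < Function.minimalPeriod (step x y) d :=
  Function.minimalPeriod_pos_of_mem_periodicPts ((step_injective x y).mem_periodicPts _)

theorem IsLoopStart.not_reaches {x y : CBDiagram m n} {j : Fin n} (h : IsLoopStart x y j) :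
    ¬ Reaches x y (central j) := fun ⟨a, ha⟩ => h.1 a ha

/-- Different positions on closed loops, each starting at its leftmost central node, are positions
at different central nodes. -/
theorem isLoopStart_index_injective {x y : CBDiagram m n} {j j' : Fin n} {a a' : ℕ}
    (hj : IsLoopStart x y j) (hj' : IsLoopStart x y j')
    (ha : a < Function.minimalPeriod (step x y) (central j))
    (ha' : a' < Function.minimalPeriod (step x y) (central j'))
    (h : index ((step x y)^[a] (central j)) = index ((step x y)^[a'] (central j'))) :
    j = j' ∧ a = a' := by
  have key : ∀ {j j' : Fin n}, IsLoopStart x y j →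
      (Leads x y (central j) (central j') ∨ Leads x y (central j) (glue (central j'))) →
      j ≤ j' := by
    rintro j j' hj (⟨a, ha⟩ | ⟨a, ha⟩)
    · exact hj.2 a j' (Or.inl ha)
    · exact hj.2 a j' (Or.inr ha)
  have l : Leads x y (central j) ((step x y)^[a] (central j)) := ⟨a, rfl⟩
  have l' : Leads x y (central j') ((step x y)^[a'] (central j')) := ⟨a', rfl⟩
  rcases eq_or_eq_glue_of_index_eq (hj.1 a) (hj'.1 a') h with h1 | h1
  · rw [h1] at l
    obtain rfl := le_antisymm (key hj (Or.inl (l.trans l'.symm)))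
      (key hj' (Or.inl (l'.trans l.symm)))
    exact ⟨rfl, Function.iterate_injOn_Iio_minimalPeriod ha ha' h1⟩
  · rw [h1] at l
    have l2 := l.trans l'.glue.symm
    have l3 : Leads x y (central j') (glue (central j)) := by
      simpa only [glue_glue] using l2.symm.glue
    obtain rfl := le_antisymm (key hj (Or.inr l2)) (key hj' (Or.inr l3))
    exact absurd l2 (not_leads_glue hj.not_reaches)

theorem exists_isLoopStart {x y : CBDiagram m n} {i : Fin n} (hi : ¬ Reaches x y (central i)) :
    ∃ j, IsLoopStart x y j ∧ ∃ a < Function.minimalPeriod (step x y) (central j),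
      index ((step x y)^[a] (central j)) = i := by
  classical
  let S : Finset (Fin n) := {k | Leads x y (central i) (central k) ∨
    Leads x y (central i) (glue (central k))}
  have hS : ∀ k, k ∈ S ↔ Leads x y (central i) (central k) ∨
    Leads x y (central i) (glue (central k)) := by simp [S]
  have hne : S.Nonempty := ⟨i, (hS i).2 (Or.inl ⟨0, rfl⟩)⟩
  have hj := (hS _).1 (S.min'_mem hne)
  set j := S.min' hne with hjdef
  -- The leftmost node of the loop may be met upwards when starting downwards at `i`; then the loop
  -- is traversed in the opposite direction.
  obtain ⟨e, he, hei, hji⟩ : ∃ e, (∀ d, Leads x y e d → Leads x y (central i) d ∨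
      Leads x y (central i) (glue d)) ∧ index e = i ∧ Leads x y (central j) e := by
    rcases hj with hj | hj
    · exact ⟨central i, fun d hd => Or.inl hd, rfl, hj.symm⟩
    · refine ⟨glue (central i), fun d hd => Or.inr ?_, index_glue _, ?_⟩
      · simpa only [glue_glue] using hd.glue
      · simpa only [glue_glue] using hj.symm.glue
  have hnr : ¬ Reaches x y (central j) := by
    intro h
    rcases hj with hj | hj
    · exact hi (h.of_leads hj.symm)
    · exact hi (h.glue.of_leads hj.symm)
  refine ⟨j, ⟨fun a ha => hnr ⟨a, ha⟩, fun a k hk => S.min'_le _ ((hS k).2 ?_)⟩, ?_⟩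
  · have hl := he _ (hji.symm.trans ⟨a, rfl⟩)
    rcases hk with hk | hk <;> rw [hk] at hl
    · exact hl
    · rw [glue_glue] at hl
      exact hl.symm
  · obtain ⟨a, ha⟩ := hji
    refine ⟨a % Function.minimalPeriod (step x y) (central j),
      Nat.mod_lt _ (minimalPeriod_step_pos x y _), ?_⟩
    rw [Function.iterate_mod_minimalPeriod_eq, ha, hei]

open Classical in
/-- The closed loops, each oriented downwards at its leftmost central node, pass exactly once
through each central node that is not on a strand with ends on the outer frame. -/
theorem sum_loops_index {M : Type*} [AddCommMonoid M] (x y : CBDiagram m n) (f : Fin n → M) :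
    (∑ j, if IsLoopStart x y j then
      ∑ a ∈ Finset.range (Function.minimalPeriod (step x y) (central j)),
        f (index ((step x y)^[a] (central j))) else 0) =
      ∑ i, if Reaches x y (central i) then 0 else f i := by
  rw [← Finset.sum_filter, Finset.sum_sigma']
  simp_rw [← ite_not (Reaches x y _)]
  rw [← Finset.sum_filter]
  refine Finset.sum_bij (fun p _ => index ((step x y)^[p.2] (central p.1))) ?_ ?_ ?_ ?_
  · rintro ⟨j, a⟩ ha
    simp only [Finset.mem_sigma, Finset.mem_filter, Finset.mem_univ, true_and,
      Finset.mem_range] at ha ⊢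
    intro h
    have h1 : Reaches x y ((step x y)^[a] (central j)) := by
      rcases eq_central_or_of_not_isOuter (ha.1.1 a) with h2 | h2 <;> rw [h2]
      · exact h
      · exact h.glue
    exact ha.1.not_reaches (h1.of_leads (Leads.symm ⟨a, rfl⟩))
  · rintro ⟨j, a⟩ ha ⟨j', a'⟩ ha' h
    simp only [Finset.mem_sigma, Finset.mem_filter, Finset.mem_univ, true_and,
      Finset.mem_range] at ha ha'
    obtain ⟨rfl, rfl⟩ := isLoopStart_index_injective ha.1 ha'.1 ha.2 ha'.2 h
    rfl
  · intro i hi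
    simp only [Finset.mem_filter, Finset.mem_univ, true_and] at hi
    obtain ⟨j, hj, a, ha, h⟩ := exists_isLoopStart hi
    exact ⟨⟨j, a⟩, by simp [hj, ha], h⟩
  · intros; rfl

/-! ### Changes of labels -/

/-- The diagram `d` with the label of each strand changed by the difference of the values of `g` at
its two ends; a function `g` in this role is called a gauge. -/
def relabel (d : CBDiagram m n) (g : CBNode n → ZMod m) : CBDiagram m n where
  partner := d.partner
  label v := d.label v + (g v - g (d.partner v))
  partner_partner := d.partner_partner
  partner_ne := d.partner_ne
  label_partner v := by rw [d.partner_partner, d.label_partner]; ring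

theorem relabel_relabel (d : CBDiagram m n) (g h : CBNode n → ZMod m) :
    (d.relabel g).relabel h = d.relabel (g + h) := by
  ext v
  · rfl
  · simp only [relabel, Pi.add_apply]; ring

theorem relabel_zero (d : CBDiagram m n) : d.relabel 0 = d := by
  ext v
  · rfl
  · simp [relabel]

/-- The values of `g` on the northern and of `h` on the southern nodes. -/
def outerPart {M : Type*} (g h : CBNode n → M) : CBNode n → M :=
  Sum.elim (fun i => g (Sum.inl i)) fun i => h (Sum.inr i)

/-- The difference of two gauges at the central nodes of a concatenation. -/
def centralPart {M : Type*} [Sub M] (g h : CBNode n → M) (i : Fin n) : M :=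
  h (Sum.inl i) - g (Sum.inr i)

theorem elim_sub_elim_glue {M : Type*} [AddGroup M] (g h : CBNode n → M) (d : CBPoint n) :
    Sum.elim g h d - Sum.elim g h (CBPoint.glue d) = crossing (centralPart g h) d := by
  rcases d with (_ | _) | (_ | _) <;> simp [CBPoint.glue, crossing, downward, centralPart]

theorem elim_ofNode {M : Type*} (g h : CBNode n → M) (v : CBNode n) :
    Sum.elim g h (ofNode v) = outerPart g h v := by
  rcases v with _ | _ <;> rfl

theorem labelAt_relabel (x y : CBDiagram m n) (g h : CBNode n → ZMod m) (d : CBPoint n) :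
    labelAt (x.relabel g) (y.relabel h) d =
      labelAt x y d + (Sum.elim g h d - Sum.elim g h (across x y d)) := by
  rcases d with d | d <;> rfl

theorem sum_iterate_succ {M : Type*} [AddCommGroup M] (x y : CBDiagram m n) (f : CBPoint n → M)
    (d : CBPoint n) {L : ℕ} (hL : f ((step x y)^[L] d) = f d) :
    ∑ a ∈ Finset.range L, f ((step x y)^[a + 1] d) =
      ∑ a ∈ Finset.range L, f ((step x y)^[a] d) := by
  have h1 := Finset.sum_range_succ (fun a => f ((step x y)^[a] d)) L
  rw [Finset.sum_range_succ', hL] at h1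
  exact add_right_cancel h1

/-- The labels along a part of a strand change by a telescoping sum, up to the contributions of the
central nodes. -/
theorem sum_labelAt_relabel (x y : CBDiagram m n) (g h : CBNode n → ZMod m) (d : CBPoint n) {L : ℕ}
    (hL : crossing (centralPart g h) ((step x y)^[L] d) = crossing (centralPart g h) d) :
    ∑ a ∈ Finset.range L, labelAt (x.relabel g) (y.relabel h) ((step x y)^[a] d) =
      ∑ a ∈ Finset.range L, labelAt x y ((step x y)^[a] d) +
      (Sum.elim g h d - Sum.elim g h ((step x y)^[L] d)) +
      ∑ a ∈ Finset.range L, crossing (centralPart g h) ((step x y)^[a] d) := by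
  rw [← sum_iterate_succ x y _ d hL]
  clear hL
  induction L with
  | zero => simp
  | succ L ih =>
    rw [Finset.sum_range_succ, ih, Finset.sum_range_succ, Finset.sum_range_succ, labelAt_relabel,
      ← elim_sub_elim_glue]
    have h1 : CBPoint.glue ((step x y)^[L + 1] d) = across x y ((step x y)^[L] d) := by
      rw [Function.iterate_succ_apply', step, glue_glue]
    rw [h1]
    ring

theorem crossing_of_isOuter {M : Type*} [AddGroup M] (f : Fin n → M) {d : CBPoint n}
    (h : IsOuter d) : crossing f d = 0 := by
  rw [crossing, show CBPoint.glue d = d from h, sub_self]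

/-- The sum of the values of `D` at the central nodes which are passed downwards on the way from the
node `v` of the outer frame to the other end of its strand. -/
noncomputable def pathDown {M : Type*} [AddCommMonoid M] (x y : CBDiagram m n) (D : Fin n → M)
    (v : CBNode n) : M :=
  ∑ a ∈ Finset.range (pathLength x y v), downward D ((step x y)^[a] (ofNode v))

/-- The other orientation of a strand passes downwards where the given one passes upwards. -/
theorem sum_crossing_path {M : Type*} [AddCommGroup M] (x y : CBDiagram m n) (D : Fin n → M)
    (v : CBNode n) :
    ∑ a ∈ Finset.range (pathLength x y v), crossing D ((step x y)^[a] (ofNode v)) =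
      pathDown x y D v - pathDown x y D (pathEnd x y v) := by
  have h1 : pathDown x y D (pathEnd x y v) =
      ∑ a ∈ Finset.range (pathLength x y v),
        downward D (CBPoint.glue ((step x y)^[a] (ofNode v))) := by
    rw [pathDown, pathLength_pathEnd,
      ← sum_iterate_succ x y (fun d => downward D (CBPoint.glue d)) (ofNode v),
      ← Finset.sum_range_reflect]
    · refine Finset.sum_congr rfl fun a ha => ?_
      rw [Finset.mem_range] at ha
      rw [iterate_pathEnd x y v (by omega)]
      congr 4
      omega
    · rw [show CBPoint.glue (ofNode v) = ofNode v from isOuter_ofNode v,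
        downward_of_isOuter _ (isOuter_ofNode v),
        downward_of_isOuter _ (isOuter_glue.2 (isOuter_pathLength x y v))]
  rw [h1, pathDown, ← Finset.sum_sub_distrib]
  rfl

/-- A change of labels of the factors changes the labels of the concatenation by a gauge as well. -/
theorem concat_relabel (x y : CBDiagram m n) (g h : CBNode n → ZMod m) :
    (x.relabel g).concat (y.relabel h) =
      (x.concat y).relabel (outerPart g h + pathDown x y (centralPart g h)) := by
  ext v
  · rfl
  · change ∑ a ∈ Finset.range (pathLength x y v),
      labelAt (x.relabel g) (y.relabel h) ((step x y)^[a] (ofNode v)) = _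
    rw [sum_labelAt_relabel, sum_crossing_path, ← ofNode_pathEnd, elim_ofNode, elim_ofNode]
    · change _ = pathLabel x y v + (_ - (outerPart g h + _) (pathEnd x y v))
      simp only [Pi.add_apply, pathLabel]
      ring
    · rw [crossing_of_isOuter _ (isOuter_ofNode v),
        crossing_of_isOuter _ (isOuter_pathLength x y v)]

/-- The sum of the values of `D` at the central nodes of the closed loop through `j`, with a minus
sign where the loop is passed upwards. -/
noncomputable def loopSum {M : Type*} [AddCommGroup M] (x y : CBDiagram m n) (D : Fin n → M)
    (j : Fin n) : M :=
  ∑ a ∈ Finset.range (Function.minimalPeriod (step x y) (central j)),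
    crossing D ((step x y)^[a] (central j))

theorem loopLabel_relabel (x y : CBDiagram m n) (g h : CBNode n → ZMod m) (j : Fin n) :
    loopLabel (x.relabel g) (y.relabel h) j =
      loopLabel x y j + loopSum x y (centralPart g h) j := by
  change ∑ a ∈ Finset.range (Function.minimalPeriod (step x y) (central j)),
      labelAt (x.relabel g) (y.relabel h) ((step x y)^[a] (central j)) = _
  rw [sum_labelAt_relabel]
  · rw [Function.iterate_minimalPeriod, sub_self, add_zero]
    rfl
  · rw [Function.iterate_minimalPeriod]

theorem loopFactor_relabel_of_centralPart_eq_zero {k : Type*} [CommSemiring k] (δ : ZMod m → k)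
    (x y : CBDiagram m n) (g h : CBNode n → ZMod m) (H : centralPart g h = 0) :
    loopFactor δ (x.relabel g) (y.relabel h) = loopFactor δ x y := by
  unfold loopFactor
  refine Finset.prod_congr rfl fun j _ => ?_
  rw [loopLabel_relabel, H]
  have : loopSum x y (0 : Fin n → ZMod m) j = 0 := by
    refine Finset.sum_eq_zero fun a _ => ?_
    generalize (step x y)^[a] (central j) = d
    rcases d with (_ | _) | (_ | _) <;> simp [crossing, downward, CBPoint.glue]
  rw [this, add_zero]
  rfl

theorem concat_relabel_of_centralPart_eq_zero (x y : CBDiagram m n) (g h : CBNode n → ZMod m)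
    (H : centralPart g h = 0) :
    (x.relabel g).concat (y.relabel h) = (x.concat y).relabel (outerPart g h) := by
  rw [concat_relabel, H]
  congr 1
  have : pathDown x y (0 : Fin n → ZMod m) = 0 := by
    funext v
    refine Finset.sum_eq_zero fun a _ => ?_
    generalize (step x y)^[a] (ofNode v) = d
    rcases d with (_ | _) | (_ | _) <;> simp [downward]
  rw [this, add_zero]

end CBDiagram

/-! ### Balanced diagrams -/

namespace CBDiagram

open CBPoint

variable {m n : ℕ}

/-- The weight `w i` at the northern node `i` and `-w i` at the southern node `i`. -/
def nodeWeight (w : Fin n → ZMod m) : CBNode n → ZMod m :=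
  Sum.elim w fun i => -w i

/-- The node weights as a function on the points of a concatenation. -/
def pointWeight (w : Fin n → ZMod m) : CBPoint n → ZMod m :=
  Sum.elim (nodeWeight w) (nodeWeight w)

/-- The pairing of a gauge with the node weights. -/
def pairing (w : Fin n → ZMod m) (g : CBNode n → ZMod m) : ZMod m :=
  ∑ v, nodeWeight w v * g v

/-- The node weights at the two ends of each strand are opposite. -/
def IsBalanced {l : ℕ} (w : Fin n → ZMod m) (d : CBDiagram l n) : Prop :=
  ∀ v, nodeWeight w (d.partner v) = -nodeWeight w v

theorem pairing_add (w : Fin n → ZMod m) (g h : CBNode n → ZMod m) :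
    pairing w (g + h) = pairing w g + pairing w h := by
  simp only [pairing, Pi.add_apply, mul_add, Finset.sum_add_distrib]

theorem pairing_add_pairing (w : Fin n → ZMod m) (g h : CBNode n → ZMod m) :
    pairing w g + pairing w h =
      pairing w (outerPart g h) + ∑ i, w i * centralPart g h i := by
  simp only [pairing, Fintype.sum_sum_type, nodeWeight, outerPart, centralPart, Sum.elim_inl,
    Sum.elim_inr, mul_sub, Finset.sum_sub_distrib, neg_mul, Finset.sum_neg_distrib]
  ring

theorem pairing_eq_zero {w : Fin n → ZMod m} {d : CBDiagram m n} (hd : d.IsBalanced w)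
    {g : CBNode n → ZMod m} (hg : ∀ v, g (d.partner v) = g v) : pairing w g = 0 := by
  refine Finset.sum_involution (fun v _ => d.partner v) ?_ ?_ ?_ ?_
  · intro v _
    rw [hd, hg]
    ring
  · intro v _ _
    exact d.partner_ne v
  · intros; exact Finset.mem_univ _
  · intro v _
    exact d.partner_partner v

theorem pairing_eq_of_relabel_eq {w : Fin n → ZMod m} {d : CBDiagram m n} (hd : d.IsBalanced w)
    {g h : CBNode n → ZMod m} (hgh : d.relabel g = d.relabel h) : pairing w g = pairing w h := by
  have h0 : pairing w (g - h) = 0 := by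
    refine pairing_eq_zero hd fun v => ?_
    have := congrFun (congrArg label hgh) v
    simp only [relabel, add_right_inj] at this
    simp only [Pi.sub_apply]
    linear_combination -this
  have h1 := pairing_add w (g - h) h
  rwa [sub_add_cancel, h0, zero_add] at h1

/-- Every labelling of a diagram arises from every other one by a change of labels with a gauge. -/
theorem exists_relabel_eq {d e : CBDiagram m n} (h : d.partner = e.partner) :
    ∃ g, d = e.relabel g := by
  -- The label of a strand is put at that end which comes first in an auxiliary linear order.
  let f : CBNode n → Fin (n + n) := finSumFinEquiv
  have hf : Function.Injective f := finSumFinEquiv.injective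
  refine ⟨fun v => if f v < f (d.partner v) then d.label v - e.label v else 0, ?_⟩
  ext v
  · exact congrFun h v
  · simp only [relabel, ← h, d.partner_partner]
    rcases lt_trichotomy (f v) (f (d.partner v)) with h1 | h1 | h1
    · rw [if_pos h1, if_neg h1.not_gt]
      ring
    · exact absurd (hf h1).symm (d.partner_ne v)
    · rw [if_neg h1.not_gt, if_pos h1, d.label_partner, h, e.label_partner]
      ring

section Weights

variable {w : Fin n → ZMod m} {x y : CBDiagram m n}

/-- The weight is constant along a strand of the concatenation of balanced diagrams. -/
theorem pointWeight_iterate (hx : x.IsBalanced w) (hy : y.IsBalanced w) (d : CBPoint n) (a : ℕ)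
    (h : ∀ b, 0 < b → b ≤ a → ¬ IsOuter ((step x y)^[b] d)) :
    pointWeight w ((step x y)^[a] d) = pointWeight w d := by
  induction a with
  | zero => rfl
  | succ a ih =>
    rw [← ih fun b h0 hb => h b h0 (by omega)]
    have ho := h (a + 1) (by omega) le_rfl
    rw [Function.iterate_succ_apply'] at ho ⊢
    generalize (step x y)^[a] d = e at ho ⊢
    have h1 : pointWeight w (across x y e) = -pointWeight w e := by
      rcases e with e | e
      · exact hx e
      · exact hy e
    rw [step, isOuter_glue] at ho
    rw [step, ← neg_eq_iff_eq_neg.2 h1]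
    generalize across x y e = c at ho
    rcases c with (_ | _) | (_ | _)
    · exact absurd rfl ho
    · exact (neg_neg _).symm
    · rfl
    · exact absurd rfl ho

theorem pointWeight_mul_downward (w D : Fin n → ZMod m) (d : CBPoint n) :
    pointWeight w d * downward D d = downward (fun i => w i * D i) d := by
  rcases d with (_ | _) | (_ | _) <;> simp [pointWeight, nodeWeight, downward]

theorem pointWeight_mul_crossing (w D : Fin n → ZMod m) {d : CBPoint n} (hd : ¬ IsOuter d) :
    pointWeight w d * crossing D d = w (index d) * D (index d) := by
  rcases d with (_ | _) | (_ | _)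
  · exact absurd rfl hd
  · simp [pointWeight, nodeWeight, crossing, downward, CBPoint.glue, index]
  · simp [pointWeight, nodeWeight, crossing, downward, CBPoint.glue, index]
  · exact absurd rfl hd

theorem pointWeight_ofNode (w : Fin n → ZMod m) (v : CBNode n) :
    pointWeight w (ofNode v) = nodeWeight w v := by
  rcases v with _ | _ <;> rfl

open Classical in
theorem pairing_pathDown (hx : x.IsBalanced w) (hy : y.IsBalanced w) (D : Fin n → ZMod m) :
    pairing w (pathDown x y D) = ∑ i, if Reaches x y (central i) then w i * D i else 0 := by
  rw [← sum_paths_downward, pairing]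
  refine Finset.sum_congr rfl fun v _ => ?_
  rw [pathDown, Finset.mul_sum]
  refine Finset.sum_congr rfl fun a ha => ?_
  rw [Finset.mem_range] at ha
  rw [← pointWeight_mul_downward, pointWeight_iterate hx hy, pointWeight_ofNode]
  exact fun b h0 hb => not_isOuter_of_lt h0 (by omega)

open Classical in
theorem sum_weight_mul_loopSum (hx : x.IsBalanced w) (hy : y.IsBalanced w)
    (D : Fin n → ZMod m) :
    (∑ j, if IsLoopStart x y j then w j * loopSum x y D j else 0) =
      ∑ i, if Reaches x y (central i) then 0 else w i * D i := by
  rw [← sum_loops_index x y fun i => w i * D i]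
  refine Finset.sum_congr rfl fun j _ => ?_
  split_ifs with hj
  · rw [loopSum, Finset.mul_sum]
    refine Finset.sum_congr rfl fun a _ => ?_
    rw [← pointWeight_mul_crossing w D (hj.1 a),
      pointWeight_iterate hx hy _ _ fun b _ _ => hj.1 b]
    rfl
  · rfl

open Classical in
/-- The contribution of the central nodes is distributed over the strands with ends on the outer
frame and the closed loops, because the weight is constant along a strand. -/
theorem sum_weight_mul (hx : x.IsBalanced w) (hy : y.IsBalanced w) (D : Fin n → ZMod m) :
    ∑ i, w i * D i = pairing w (pathDown x y D) +
      ∑ j, if IsLoopStart x y j then w j * loopSum x y D j else 0 := by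
  rw [pairing_pathDown hx hy, sum_weight_mul_loopSum hx hy, ← Finset.sum_add_distrib]
  refine Finset.sum_congr rfl fun i _ => ?_
  split_ifs <;> simp

end Weights

/-! ### Averaging over the closed loops -/

open Classical in
/-- Labels at the leftmost nodes of the closed loops are added to the labels of these loops, one
label to each loop. -/
theorem loopSum_add_ite (x y : CBDiagram m n) (D u : Fin n → ZMod m) {j : Fin n}
    (hj : IsLoopStart x y j) :
    loopSum x y (D + fun i => if IsLoopStart x y i then u i else 0) j =
      loopSum x y D j + u j := by
  have hadd : ∀ d : CBPoint n, crossing (D + fun i => if IsLoopStart x y i then u i else 0) d =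
      crossing D d + crossing (fun i => if IsLoopStart x y i then u i else 0) d := by
    rintro ((_ | _) | (_ | _)) <;> simp [crossing, downward, CBPoint.glue]
    ring
  simp only [loopSum, hadd, Finset.sum_add_distrib]
  congr 1
  have hpos := minimalPeriod_step_pos x y (central j)
  rw [Finset.sum_eq_single_of_mem 0 (Finset.mem_range.2 hpos)]
  · simp [crossing, downward, CBPoint.glue, central, hj]
  · intro a ha h0
    rw [Finset.mem_range] at ha
    have hi : ¬ IsLoopStart x y (index ((step x y)^[a] (central j))) := fun h =>
      h0 (isLoopStart_index_injective hj h ha (minimalPeriod_step_pos x y _) rfl).2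
    have h1 := eq_central_or_of_not_isOuter (hj.1 a)
    generalize (step x y)^[a] (central j) = e at h1 hi ⊢
    generalize index e = i at h1 hi
    rcases h1 with rfl | rfl <;> simp [crossing, downward, CBPoint.glue, central, hi]

open Classical in
/-- The labels of the closed loops are independent and uniformly distributed: the average over all
labels `D` of the central nodes is a product of averages, one for each closed loop. -/
theorem sum_prod_loopSum {k : Type*} [Field k] [NeZero m] (hm : (m : k) ≠ 0)
    (x y : CBDiagram m n) (f : Fin n → ZMod m → k) :
    ∑ D : Fin n → ZMod m, ∏ j, (if IsLoopStart x y j then f j (loopSum x y D j) else 1) =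
      ∏ j, if IsLoopStart x y j then ∑ u, f j u else (m : k) := by
  set Φ : (Fin n → ZMod m) → k := fun D =>
    ∏ j, (if IsLoopStart x y j then f j (loopSum x y D j) else 1) with hΦ
  have hcard : (Fintype.card (Fin n → ZMod m) : k) ≠ 0 := by
    simp [ZMod.card, hm]
  have h1 : ∀ D, ∑ u : Fin n → ZMod m,
      Φ (D + fun i => if IsLoopStart x y i then u i else 0) =
      ∏ j, if IsLoopStart x y j then ∑ u, f j u else (m : k) := by
    intro D
    calc _ = ∑ u : Fin n → ZMod m, ∏ j,
          (if IsLoopStart x y j then f j (loopSum x y D j + u j) else 1) := by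
          refine Finset.sum_congr rfl fun u _ => Finset.prod_congr rfl fun j _ => ?_
          split_ifs with hj
          · rw [loopSum_add_ite x y D u hj]
          · rfl
      _ = ∏ j, ∑ u : ZMod m,
          (if IsLoopStart x y j then f j (loopSum x y D j + u) else 1) :=
          (Fintype.prod_sum fun j u =>
            (if IsLoopStart x y j then f j (loopSum x y D j + u) else (1 : k))).symm
      _ = _ := by
          refine Finset.prod_congr rfl fun j _ => ?_
          split_ifs with hj
          · exact Equiv.sum_comp (Equiv.addLeft (loopSum x y D j)) (f j)
          · simp [ZMod.card]
  have h2 : ∀ u : Fin n → ZMod m, ∑ D : Fin n → ZMod m,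
      Φ (D + fun i => if IsLoopStart x y i then u i else 0) = ∑ D, Φ D := fun u =>
    Equiv.sum_comp (Equiv.addRight (fun i => if IsLoopStart x y i then u i else 0)) Φ
  -- Each sum over `D` is invariant under a shift at the leftmost nodes of the loops; the average
  -- over all these shifts makes the labels of the loops independent.
  refine mul_left_cancel₀ hcard ?_
  calc _ = ∑ u : Fin n → ZMod m, ∑ D, Φ D := by simp
    _ = ∑ u : Fin n → ZMod m, ∑ D : Fin n → ZMod m,
        Φ (D + fun i => if IsLoopStart x y i then u i else 0) := by simp only [h2]
    _ = _ := by
      rw [Finset.sum_comm]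
      simp only [h1]
      simp

end CBDiagram

/-! ### Averages of diagrams -/

namespace CyclotomicBrauer

open CBDiagram

theorem map_sum_eq_prod {k : Type*} [CommRing k] {m : ℕ} (ψ : AddChar (ZMod m) k) {ι : Type*}
    (s : Finset ι) (f : ι → ZMod m) :
    ψ (∑ i ∈ s, f i) = ∏ i ∈ s, ψ (f i) := by
  classical
  induction s using Finset.induction_on with
  | empty => simp
  | insert i s hi ih =>
    rw [Finset.sum_insert hi, Finset.prod_insert hi, AddChar.map_add_eq_mul, ih]

variable {k : Type*} [Field k] {m n : ℕ} [NeZero m] {δ : ZMod m → k}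

/-- The average of all labellings of the diagram `d`, twisted by the character of the gauge group
that is given by `ψ` and the weights `w`. -/
noncomputable def average (ψ : AddChar (ZMod m) k) (δ : ZMod m → k) (w : Fin n → ZMod m)
    (d : CBDiagram m n) : CyclotomicBrauer k m n δ :=
  ((m : k) ^ (n + n))⁻¹ • ∑ g : CBNode n → ZMod m, ψ (pairing w g) • of (d.relabel g)

/-- The Fourier coefficient of the parameters `δ` at the character `u ↦ ψ (r * u)`. -/
noncomputable def charParameter (ψ : AddChar (ZMod m) k) (δ : ZMod m → k) (r : ZMod m) : k :=
  (m : k)⁻¹ * ∑ u, ψ (r * u) * δ u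

variable {ψ : AddChar (ZMod m) k} {w : Fin n → ZMod m}

theorem average_relabel (d : CBDiagram m n) (g : CBNode n → ZMod m) :
    average ψ δ w (d.relabel g) = ψ (-pairing w g) • average ψ δ w d := by
  rw [average, average, smul_comm (ψ (-pairing w g))]
  congr 1
  rw [Finset.smul_sum, ← Equiv.sum_comp (Equiv.addLeft g) fun h =>
    ψ (-pairing w g) • ψ (pairing w h) • (of (d.relabel h) : CyclotomicBrauer k m n δ)]
  refine Finset.sum_congr rfl fun h _ => ?_
  rw [relabel_relabel, Equiv.coe_addLeft, smul_smul, ← AddChar.map_add_eq_mul, pairing_add,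
    neg_add_cancel_left]

/-- The average of a diagram that is not balanced vanishes, because `ψ` is faithful. -/
theorem average_eq_zero (hψ : ∀ a, ψ a = 1 → a = 0) {d : CBDiagram m n}
    (hd : ¬ d.IsBalanced w) : average ψ δ w d = 0 := by
  simp only [IsBalanced, not_forall] at hd
  obtain ⟨v, hv⟩ := hd
  -- A gauge that is constant on the unbalanced strand fixes the diagram, but not its average.
  let g : CBNode n → ZMod m := Pi.single v 1 + Pi.single (d.partner v) 1
  have hg : d.relabel g = d := by
    ext u
    · rfl
    · have h1 : d.partner u = d.partner v ↔ u = v :=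
        ⟨fun h => by rw [← d.partner_partner u, h, d.partner_partner], fun h => by rw [h]⟩
      have h2 : d.partner u = v ↔ u = d.partner v :=
        ⟨fun h => by rw [← h, d.partner_partner], fun h => by rw [h, d.partner_partner]⟩
      simp only [relabel, g, Pi.add_apply, Pi.single_apply, h1, h2]
      ring
  have hp : pairing w g = nodeWeight w v + nodeWeight w (d.partner v) := by
    simp [pairing, g, mul_add, Finset.sum_add_distrib, Pi.single_apply]
  have h1 := average_relabel (ψ := ψ) (δ := δ) (w := w) d g
  rw [hg] at h1
  have h2 : (1 - ψ (-pairing w g)) • average ψ δ w d = 0 := by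
    rw [sub_smul, one_smul, ← h1, sub_self]
  refine (smul_eq_zero.1 h2).resolve_left fun h => hv ?_
  have h3 := hψ _ (sub_eq_zero.1 h).symm
  rw [hp] at h3
  linear_combination -h3

/-- Summation over a pair of gauges, in terms of their part on the outer frame and their difference
at the central nodes. -/
theorem sum_sum_outerPart_centralPart {M : Type*} [AddCommMonoid M]
    (F : (CBNode n → ZMod m) → (Fin n → ZMod m) → M) :
    ∑ g : CBNode n → ZMod m, ∑ h : CBNode n → ZMod m, F (outerPart g h) (centralPart g h) =
      m ^ n • ∑ g : CBNode n → ZMod m, ∑ D : Fin n → ZMod m, F g D := by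
  let e : (CBNode n → ZMod m) × (CBNode n → ZMod m) ≃
      (Fin n → ZMod m) × (CBNode n → ZMod m) × (Fin n → ZMod m) :=
    { toFun := fun p => (fun i => p.1 (Sum.inr i), outerPart p.1 p.2, centralPart p.1 p.2)
      invFun := fun q => (Sum.elim (fun i => q.2.1 (Sum.inl i)) q.1,
        Sum.elim (q.2.2 + q.1) fun i => q.2.1 (Sum.inr i))
      left_inv := by
        rintro ⟨g, h⟩
        ext (i | i) <;> simp [outerPart, centralPart]
      right_inv := by
        rintro ⟨s, g, D⟩
        refine Prod.ext rfl (Prod.ext ?_ ?_)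
        · funext i
          rcases i with i | i <;> rfl
        · funext i
          simp [centralPart] }
  rw [← Fintype.sum_prod_type' (f := fun g h => F (outerPart g h) (centralPart g h)),
    ← Fintype.sum_prod_type' (f := F)]
  have he := Equiv.sum_comp e fun q => F q.2.1 q.2.2
  refine he.trans ((Fintype.sum_prod_type _).trans ?_)
  simp [ZMod.card]

open Classical in
/-- In a product of averages of unlabelled diagrams each closed loop contributes the Fourier
coefficient of `δ` at the weight of its leftmost central node. -/
theorem average_mul_average (hm : (m : k) ≠ 0) {x y : CBDiagram m n} (hx : x.IsBalanced w)
    (hy : y.IsBalanced w) (hx0 : ∀ v, x.label v = 0) (hy0 : ∀ v, y.label v = 0) :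
    average ψ δ w x * average ψ δ w y =
      (∏ j, if IsLoopStart x y j then charParameter ψ δ (w j) else 1) •
        average ψ δ w (x.concat y) := by
  have hloop : ∀ g h, loopFactor δ (x.relabel g) (y.relabel h) =
      ∏ j, if IsLoopStart x y j then δ (loopSum x y (centralPart g h) j) else 1 := by
    intro g h
    refine Finset.prod_congr rfl fun j _ => ?_
    have h0 : loopLabel x y j = 0 := by
      refine Finset.sum_eq_zero fun a _ => ?_
      generalize (step x y)^[a] (CBPoint.central j) = d
      rcases d with d | d
      · exact hx0 d
      · exact hy0 d
    rw [loopLabel_relabel, h0, zero_add]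
    rfl
  set lf : (Fin n → ZMod m) → k := fun D =>
    ∏ j, if IsLoopStart x y j then δ (loopSum x y D j) else 1 with hlf
  have hpow : ((m : k) ^ (n + n)) ≠ 0 := pow_ne_zero _ hm
  -- The sum over the gauges on the outer frame is again an average.
  have hav : ∀ D, ∑ g : CBNode n → ZMod m, ψ (pairing w g) •
      (of (((x.concat y).relabel (g + pathDown x y D))) : CyclotomicBrauer k m n δ) =
      ((m : k) ^ (n + n) * ψ (-pairing w (pathDown x y D))) • average ψ δ w (x.concat y) := by
    intro D
    rw [mul_smul, ← average_relabel, average, smul_smul, mul_inv_cancel₀ hpow, one_smul]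
    simp only [relabel_relabel, add_comm]
  have hsum : ∑ D : Fin n → ZMod m,
      (lf D * ψ (∑ i, w i * D i) * ψ (-pairing w (pathDown x y D))) =
      (m : k) ^ n * ∏ j, if IsLoopStart x y j then charParameter ψ δ (w j) else 1 := by
    calc _ = ∑ D : Fin n → ZMod m, ∏ j, (if IsLoopStart x y j then
          ψ (w j * loopSum x y D j) * δ (loopSum x y D j) else 1) := by
          refine Finset.sum_congr rfl fun D _ => ?_
          rw [mul_assoc, ← AddChar.map_add_eq_mul, sum_weight_mul hx hy, add_comm,
            neg_add_cancel_left, map_sum_eq_prod, hlf, ← Finset.prod_mul_distrib]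
          refine Finset.prod_congr rfl fun j _ => ?_
          split_ifs
          · rw [mul_comm]
          · rw [AddChar.map_zero_eq_one, one_mul]
      _ = ∏ j, (if IsLoopStart x y j then ∑ u, ψ (w j * u) * δ u else (m : k)) :=
          sum_prod_loopSum hm x y fun j u => ψ (w j * u) * δ u
      _ = ∏ j, (m : k) * (if IsLoopStart x y j then charParameter ψ δ (w j) else 1) := by
          refine Finset.prod_congr rfl fun j _ => ?_
          split_ifs
          · rw [charParameter, mul_inv_cancel_left₀ hm]
          · rw [mul_one]
      _ = _ := by rw [Finset.prod_mul_distrib]; simp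
  let G : (CBNode n → ZMod m) → (Fin n → ZMod m) → CyclotomicBrauer k m n δ := fun g D =>
    (lf D * ψ (∑ i, w i * D i)) • ψ (pairing w g) • of ((x.concat y).relabel (g + pathDown x y D))
  have hmain : ∑ g : CBNode n → ZMod m, ∑ h : CBNode n → ZMod m,
      (ψ (pairing w g) • of (x.relabel g)) * (ψ (pairing w h) • of (y.relabel h)) =
      (((m : k) ^ (n + n) * (m : k) ^ (n + n)) *
        ∏ j, if IsLoopStart x y j then charParameter ψ δ (w j) else 1) •
        average ψ δ w (x.concat y) := by
    calc _ = ∑ g : CBNode n → ZMod m, ∑ h : CBNode n → ZMod m,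
          G (outerPart g h) (centralPart g h) := by
          refine Finset.sum_congr rfl fun g _ => Finset.sum_congr rfl fun h _ => ?_
          rw [smul_mul_smul_comm, ← AddChar.map_add_eq_mul, pairing_add_pairing, of_mul_of,
            hloop, concat_relabel, AddChar.map_add_eq_mul]
          simp only [G, smul_smul]
          congr 1
          ring
      _ = _ := by
          refine (sum_sum_outerPart_centralPart G).trans ?_
          rw [Finset.sum_comm]
          simp only [G, ← Finset.smul_sum, hav]
          simp only [smul_smul]
          rw [← Finset.sum_smul, ← Nat.cast_smul_eq_nsmul k, smul_smul]
          congr 1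
          have : ∀ D : Fin n → ZMod m, lf D * ψ (∑ i, w i * D i) *
              ((m : k) ^ (n + n) * ψ (-pairing w (pathDown x y D))) = (m : k) ^ (n + n) *
              (lf D * ψ (∑ i, w i * D i) * ψ (-pairing w (pathDown x y D))) := fun D => by ring
          simp only [this]
          rw [← Finset.mul_sum, hsum]
          push_cast
          ring
  rw [average, average, smul_mul_smul_comm, Finset.sum_mul_sum, hmain, smul_smul]
  congr 1
  field_simp

end CyclotomicBrauer

/-! ### The subspace `e A e` -/

section Corner

variable {k A : Type*} [CommRing k] [NonAssocRing A] [Module k A] [IsScalarTower k A A]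
  [SMulCommClass k A A]

theorem mulRight_comp_mulLeft_apply (e a : A) :
    (LinearMap.mulRight k e ∘ₗ LinearMap.mulLeft k e) a = e * a * e := by
  rw [LinearMap.comp_apply, LinearMap.mulLeft_apply, LinearMap.mulRight_apply]

theorem mul_mul_mem_idempotentCorner (e a : A) : e * a * e ∈ idempotentCorner k e :=
  ⟨a, mulRight_comp_mulLeft_apply e a⟩

theorem idempotentCorner_eq_span {ι : Type*} (b : Module.Basis ι k A) (e : A) :
    idempotentCorner k e = Submodule.span k (Set.range fun i => e * b i * e) := by
  rw [idempotentCorner, LinearMap.range_eq_map, ← b.span_eq, Submodule.map_span, ← Set.range_comp]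
  exact congrArg _ (congrArg _ (funext fun i => mulRight_comp_mulLeft_apply e (b i)))

/-- A basis of `e A e` and a basis of `C` with the same structure constants, both of which contain
the unit element, give an isomorphism. -/
theorem cornerIsomorphic_of_basis {e : A} {C : Type*} [NonAssocSemiring C] [Module k C]
    [IsScalarTower k C C] [SMulCommClass k C C] {I : Type*}
    (b : Module.Basis I k (idempotentCorner k e)) (b' : Module.Basis I k C) (c : I → I → k)
    (op : I → I → I) (i₀ : I) (hb : (b i₀ : A) = e) (hb' : b' i₀ = 1)
    (hmul : ∀ i j, (b i : A) * b j = c i j • (b (op i j) : A))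
    (hmul' : ∀ i j, b' i * b' j = c i j • b' (op i j)) : CornerIsomorphic k e C := by
  let φ : idempotentCorner k e ≃ₗ[k] C := b.equiv b' (Equiv.refl I)
  have hφ : ∀ i, φ (b i) = b' i := fun i => by simp [φ]
  let B : idempotentCorner k e →ₗ[k] idempotentCorner k e →ₗ[k] idempotentCorner k e :=
    b.constr k fun i => b.constr k fun j => c i j • b (op i j)
  have hB : ∀ i j, B (b i) (b j) = c i j • b (op i j) := fun i j => by
    simp only [B, Module.Basis.constr_basis]
  have h1 : ∀ x y, (B x y : A) = (x : A) * y := by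
    have : B.compr₂ (idempotentCorner k e).subtype =
        (LinearMap.mul k A).compl₁₂ (idempotentCorner k e).subtype
          (idempotentCorner k e).subtype := by
      refine LinearMap.ext_basis b b fun i j => ?_
      simp [hB, hmul]
    exact fun x y => LinearMap.congr_fun₂ this x y
  have h2 : ∀ x y, φ (B x y) = φ x * φ y := by
    have : B.compr₂ φ.toLinearMap =
        (LinearMap.mul k C).compl₁₂ φ.toLinearMap φ.toLinearMap := by
      refine LinearMap.ext_basis b b fun i j => ?_
      simp [hB, hφ, hmul']
    exact fun x y => LinearMap.congr_fun₂ this x y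
  have he : e ∈ idempotentCorner k e := by
    have := (b i₀).2
    rwa [hb] at this
  refine ⟨φ, ⟨he, ?_⟩, fun x y => ⟨h1 x y ▸ (B x y).2, ?_⟩⟩
  · rw [← hb', ← hφ]
    exact congrArg φ (Subtype.ext hb.symm)
  · rw [← h2]
    exact congrArg φ (Subtype.ext (h1 x y).symm)

end Corner

/-! ### The idempotent as a sum of labelled identity diagrams -/

namespace CBDiagram

variable {m n : ℕ}

theorem relabel_idDiagram_northern (q : Fin n → ZMod m) :
    (idDiagram m n).relabel (Sum.elim q 0) = ofLabels q := by
  ext v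
  · rfl
  · rcases v with v | v <;> simp [relabel, idDiagram, ofLabels]

theorem relabel_idDiagram_southern (q : Fin n → ZMod m) :
    (idDiagram m n).relabel (Sum.elim 0 (-q)) = ofLabels q := by
  ext v
  · rfl
  · rcases v with v | v <;> simp [relabel, idDiagram, ofLabels]

end CBDiagram

namespace CyclotomicBrauer

open CBDiagram

section Labels

variable {k : Type*} [CommRing k] {m n : ℕ} {δ : ZMod m → k}

theorem of_ofLabels_mul_of (q : Fin n → ZMod m) (d : CBDiagram m n) :
    (of (ofLabels q) * of d : CyclotomicBrauer k m n δ) = of (d.relabel (Sum.elim q 0)) := by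
  have hc : centralPart (Sum.elim q 0) (0 : CBNode n → ZMod m) = 0 := by
    funext i
    simp [centralPart]
  have ho : outerPart (Sum.elim q 0) (0 : CBNode n → ZMod m) = Sum.elim q 0 := by
    funext v
    rcases v with v | v <;> simp [outerPart]
  have h1 := loopFactor_relabel_of_centralPart_eq_zero δ (idDiagram m n) d _ _ hc
  have h2 := concat_relabel_of_centralPart_eq_zero (idDiagram m n) d _ _ hc
  rw [relabel_zero, relabel_idDiagram_northern] at h1 h2
  rw [of_mul_of, h1, h2, loopFactor_idDiagram_left, concat_idDiagram_left, one_smul, ho]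

theorem of_mul_of_ofLabels (q : Fin n → ZMod m) (d : CBDiagram m n) :
    (of d * of (ofLabels q) : CyclotomicBrauer k m n δ) = of (d.relabel (Sum.elim 0 (-q))) := by
  have hc : centralPart (0 : CBNode n → ZMod m) (Sum.elim (0 : Fin n → ZMod m) (-q)) = 0 := by
    funext i
    simp [centralPart]
  have ho : outerPart (0 : CBNode n → ZMod m) (Sum.elim (0 : Fin n → ZMod m) (-q)) =
      Sum.elim (0 : Fin n → ZMod m) (-q) := by
    funext v
    rcases v with v | v <;> simp [outerPart]
  have h1 := loopFactor_relabel_of_centralPart_eq_zero δ d (idDiagram m n) _ _ hc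
  have h2 := concat_relabel_of_centralPart_eq_zero d (idDiagram m n) _ _ hc
  rw [relabel_zero, relabel_idDiagram_southern] at h1 h2
  rw [of_mul_of, h1, h2, loopFactor_idDiagram_right, concat_idDiagram_right, one_smul, ho]

theorem of_ofLabels_mul_of_ofLabels (q q' : Fin n → ZMod m) :
    (of (ofLabels q) * of (ofLabels q') : CyclotomicBrauer k m n δ) = of (ofLabels (q + q')) := by
  rw [of_ofLabels_mul_of, ← relabel_idDiagram_northern q', relabel_relabel,
    ← relabel_idDiagram_northern (q + q'), add_comm q, ← Sum.elim_add_add, add_zero]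

end Labels

variable {k : Type*} [Field k] {m n : ℕ} [NeZero m] {δ : ZMod m → k}

/-- The product of the idempotents at the nodes `i ∈ s`, for the characters of weight `w i`, as a
sum over all labellings; the labels outside of `s` are summed over without effect. -/
noncomputable def partialIdem (ψ : AddChar (ZMod m) k) (δ : ZMod m → k) (w : Fin n → ZMod m)
    (s : Finset (Fin n)) : CyclotomicBrauer k m n δ :=
  ((m : k) ^ n)⁻¹ • ∑ q : Fin n → ZMod m,
    ψ (∑ i ∈ s, w i * q i) • of (ofLabels fun i => if i ∈ s then q i else 0)

variable {ψ : AddChar (ZMod m) k} {w : Fin n → ZMod m}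

theorem partialIdem_empty (hm : (m : k) ≠ 0) : partialIdem ψ δ w ∅ = 1 := by
  have : (fun _ => 0 : Fin n → ZMod m) = 0 := rfl
  simp only [partialIdem, Finset.notMem_empty, if_false, Finset.sum_empty,
    AddChar.map_zero_eq_one, one_smul, this, Finset.sum_const, Finset.card_univ,
    Fintype.card_fun, ZMod.card, Fintype.card_fin]
  rw [← Nat.cast_smul_eq_nsmul k, smul_smul, Nat.cast_pow, inv_mul_cancel₀ (pow_ne_zero _ hm),
    one_smul]
  rfl

theorem sum_sum_piecewise {M : Type*} [AddCommMonoid M] (s : Finset (Fin n))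
    (F : (Fin n → ZMod m) → M) :
    ∑ q : Fin n → ZMod m, ∑ q' : Fin n → ZMod m, F (s.piecewise q q') = m ^ n • ∑ q, F q := by
  let e : (Fin n → ZMod m) × (Fin n → ZMod m) ≃ (Fin n → ZMod m) × (Fin n → ZMod m) :=
    Function.Involutive.toPerm (fun p => (s.piecewise p.2 p.1, s.piecewise p.1 p.2)) (by
      rintro ⟨q, q'⟩
      refine Prod.ext ?_ ?_ <;> funext i <;> by_cases hi : i ∈ s <;> simp [hi])
  have he := Equiv.sum_comp e fun p => F p.2
  rw [Fintype.sum_prod_type] at he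
  refine he.trans ((Fintype.sum_prod_type _).trans ?_)
  simp [ZMod.card]

theorem partialIdem_mul (hm : (m : k) ≠ 0) {s t : Finset (Fin n)} (h : Disjoint s t) :
    partialIdem ψ δ w s * partialIdem ψ δ w t = partialIdem ψ δ w (s ∪ t) := by
  have hpow : ((m : k) ^ n) ≠ 0 := pow_ne_zero _ hm
  let F : (Fin n → ZMod m) → CyclotomicBrauer k m n δ := fun q =>
    ψ (∑ i ∈ s ∪ t, w i * q i) • of (ofLabels fun i => if i ∈ s ∪ t then q i else 0)
  have key : ∀ q q' : Fin n → ZMod m,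
      (ψ (∑ i ∈ s, w i * q i) • of (ofLabels fun i => if i ∈ s then q i else 0)) *
        (ψ (∑ i ∈ t, w i * q' i) • of (ofLabels fun i => if i ∈ t then q' i else 0)) =
        F (s.piecewise q q') := by
    intro q q'
    rw [smul_mul_smul_comm, ← AddChar.map_add_eq_mul, of_ofLabels_mul_of_ofLabels]
    simp only [F]
    rw [Finset.sum_union h]
    have e1 : ∑ i ∈ s, w i * s.piecewise q q' i = ∑ i ∈ s, w i * q i :=
      Finset.sum_congr rfl fun i hi => by rw [Finset.piecewise_eq_of_mem _ _ _ hi]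
    have e2 : ∑ i ∈ t, w i * s.piecewise q q' i = ∑ i ∈ t, w i * q' i :=
      Finset.sum_congr rfl fun i hi => by
        rw [Finset.piecewise_eq_of_notMem _ _ _ (Finset.disjoint_right.1 h hi)]
    have e3 : ((fun i => if i ∈ s then q i else 0) + fun i => if i ∈ t then q' i else 0) =
        fun i => if i ∈ s ∪ t then s.piecewise q q' i else 0 := by
      funext i
      by_cases hs : i ∈ s
      · simp [hs, Finset.disjoint_left.1 h hs]
      · simp [hs]
    rw [e1, e2, e3]
  rw [partialIdem, partialIdem, smul_mul_smul_comm, Finset.sum_mul_sum]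
  simp only [key]
  rw [sum_sum_piecewise, ← Nat.cast_smul_eq_nsmul k, smul_smul, partialIdem]
  congr 1
  push_cast
  field_simp

theorem sum_natCast_Icc {M : Type*} [AddCommMonoid M] (f : ZMod m → M) :
    ∑ q ∈ Finset.Icc 1 m, f (q : ZMod m) = ∑ u, f u := by
  have hpos := NeZero.pos m
  refine Finset.sum_bij (fun q _ => (q : ZMod m)) (fun _ _ => Finset.mem_univ _) ?_ ?_
    fun _ _ => rfl
  · intro a ha b hb hab
    rw [Finset.mem_Icc] at ha hb
    rw [ZMod.natCast_eq_natCast_iff'] at hab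
    rcases eq_or_lt_of_le ha.2 with h1 | h1 <;> rcases eq_or_lt_of_le hb.2 with h2 | h2
    · omega
    · rw [h1, Nat.mod_self, Nat.mod_eq_of_lt h2] at hab
      omega
    · rw [h2, Nat.mod_self, Nat.mod_eq_of_lt h1] at hab
      omega
    · rwa [Nat.mod_eq_of_lt h1, Nat.mod_eq_of_lt h2] at hab
  · intro u _
    by_cases hu : u = 0
    · exact ⟨m, Finset.mem_Icc.2 ⟨hpos, le_rfl⟩, by simp [hu]⟩
    · have h0 : u.val ≠ 0 := fun h => hu ((ZMod.val_eq_zero u).1 h)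
      exact ⟨u.val, Finset.mem_Icc.2 ⟨by omega, (ZMod.val_lt u).le⟩, ZMod.natCast_zmod_val u⟩

theorem T_eq_partialIdem (hm : (m : k) ≠ 0) {ξ : k} (hξ : ξ ^ m = 1) (i : Fin n) (r : ℕ)
    (hw : w i = r) : T ξ δ i r = partialIdem (AddChar.zmodChar m hξ) δ w {i} := by
  set ψ := AddChar.zmodChar m hξ with hψ
  let K : ZMod m → CyclotomicBrauer k m n δ := fun u =>
    ψ (w i * u) • of (ofLabels (Pi.single i u))
  have h1 : T ξ δ i r = (m : k)⁻¹ • ∑ u, K u := by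
    rw [T, ← sum_natCast_Icc]
    congr 1
    refine Finset.sum_congr rfl fun q _ => ?_
    simp only [K, hw, t]
    rw [hψ, ← Nat.cast_mul, AddChar.zmodChar_apply', mul_comm r]
  have h2 : partialIdem ψ δ w {i} = ((m : k) ^ n)⁻¹ • ∑ q : Fin n → ZMod m, K (q i) := by
    rw [partialIdem]
    congr 1
    refine Finset.sum_congr rfl fun q _ => ?_
    simp only [K, Finset.sum_singleton, Finset.mem_singleton]
    congr 3
    funext j
    rw [Pi.single_apply]
    split_ifs with h
    · rw [h]
    · rfl
  let e : ZMod m × (Fin n → ZMod m) ≃ ZMod m × (Fin n → ZMod m) :=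
    Function.Involutive.toPerm (fun p => (p.2 i, Function.update p.2 i p.1)) (by
      rintro ⟨u, q⟩
      simp)
  have he := Equiv.sum_comp e fun p => K p.1
  rw [Fintype.sum_prod_type, Fintype.sum_prod_type] at he
  have h3 : m • ∑ q : Fin n → ZMod m, K (q i) = m ^ n • ∑ u, K u := by
    calc _ = ∑ _u : ZMod m, ∑ q : Fin n → ZMod m, K (q i) := by
          rw [Finset.sum_const, Finset.card_univ, ZMod.card]
      _ = ∑ u : ZMod m, ∑ _q : Fin n → ZMod m, K u := he
      _ = _ := by
          simp only [Finset.sum_const, Finset.card_univ, Fintype.card_fun, ZMod.card,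
            Fintype.card_fin, Finset.smul_sum]
  rw [← Nat.cast_smul_eq_nsmul k, ← Nat.cast_smul_eq_nsmul k, Nat.cast_pow] at h3
  have hpow : ((m : k) ^ n) ≠ 0 := pow_ne_zero _ hm
  rw [h1, h2, eq_inv_smul_iff₀ hpow, smul_comm, ← h3, inv_smul_smul₀ hm]

/-- No associativity is needed here: the product of a list is evaluated from the right. -/
theorem list_prod_eq_partialIdem (hm : (m : k) ≠ 0) {ι : Type*} (f : ι → CyclotomicBrauer k m n δ)
    (s : ι → Finset (Fin n)) (l : List ι) (hl : l.Pairwise fun i j => Disjoint (s i) (s j))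
    (hf : ∀ i ∈ l, f i = partialIdem ψ δ w (s i)) :
    (l.map f).prod = partialIdem ψ δ w {j | ∃ i ∈ l, j ∈ s i} := by
  classical
  induction l with
  | nil => simpa using (partialIdem_empty hm).symm
  | cons a l ih =>
    rw [List.pairwise_cons] at hl
    have h1 : ((a :: l).map f).prod = f a * (l.map f).prod := rfl
    rw [h1, ih hl.2 fun i hi => hf i (List.mem_cons_of_mem _ hi), hf a List.mem_cons_self,
      partialIdem_mul hm]
    · congr 1
      ext j
      simp
    · rw [Finset.disjoint_left]
      intro j hj hj'
      simp only [Finset.mem_filter, Finset.mem_univ, true_and] at hj'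
      obtain ⟨i, hi, hji⟩ := hj'
      exact Finset.disjoint_left.1 (hl.1 i hi) hj hji

theorem piIdem_eq_partialIdem (hm : (m : k) ≠ 0) {ξ : k} (hξ : ξ ^ m = 1) {ω : Fin m → ℕ}
    (blk : Fin n → Fin m) (hblk : ∀ r i, InBlock ω r i ↔ blk i = r) :
    piIdem ξ δ ω = partialIdem (AddChar.zmodChar m hξ) δ (fun i => ((blk i : ℕ) : ZMod m))
      Finset.univ := by
  classical
  rw [piIdem, list_prod_eq_partialIdem (ψ := AddChar.zmodChar m hξ)
    (w := fun i => ((blk i : ℕ) : ZMod m)) hm _ fun r => {i | blk i = r}]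
  · congr 1
    ext j
    simp
  · refine (List.nodup_finRange m).imp fun {a b} hab => ?_
    rw [Finset.disjoint_left]
    intro j h1 h2
    simp only [Finset.mem_filter, Finset.mem_univ, true_and] at h1 h2
    exact hab (h1.symm.trans h2)
  · intro r _
    rw [list_prod_eq_partialIdem (ψ := AddChar.zmodChar m hξ)
      (w := fun i => ((blk i : ℕ) : ZMod m)) hm _ fun i => {i}]
    · congr 1
      ext j
      simp [hblk]
    · refine ((List.nodup_finRange n).filter _).imp fun {a b} hab => ?_
      simpa using hab
    · intro i hi
      refine T_eq_partialIdem hm hξ i r ?_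
      have : InBlock ω r i := by simpa using hi
      rw [(hblk r i).1 this]

/-! ### The idempotent subalgebra -/

theorem sum_eq_sum_elim {M : Type*} [AddCommMonoid M] (F : (CBNode n → ZMod m) → M) :
    ∑ g, F g = ∑ q : Fin n → ZMod m, ∑ q' : Fin n → ZMod m, F (Sum.elim q q') :=
  (Equiv.sum_comp (Equiv.sumArrowEquivProdArrow _ _ _).symm F).symm.trans
    (Fintype.sum_prod_type _)

theorem partialIdem_mul_of_mul_partialIdem (d : CBDiagram m n) :
    partialIdem ψ δ w Finset.univ * of d * partialIdem ψ δ w Finset.univ = average ψ δ w d := by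
  simp only [partialIdem, Finset.mem_univ, if_true, average]
  rw [smul_mul_assoc, smul_mul_smul_comm, Finset.sum_mul, Finset.sum_mul_sum, sum_eq_sum_elim,
    pow_add, mul_inv]
  congr 1
  refine Finset.sum_congr rfl fun q _ => ?_
  rw [← Equiv.sum_comp (Equiv.neg (Fin n → ZMod m))]
  refine Finset.sum_congr rfl fun q' _ => ?_
  rw [smul_mul_assoc, smul_mul_smul_comm, of_ofLabels_mul_of, of_mul_of_ofLabels, relabel_relabel,
    ← AddChar.map_add_eq_mul, ← Sum.elim_add_add, add_zero, zero_add, Equiv.neg_apply, neg_neg]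
  simp [pairing, nodeWeight]

theorem average_mem_idempotentCorner (d : CBDiagram m n) :
    average ψ δ w d ∈ idempotentCorner k (partialIdem ψ δ w Finset.univ) :=
  partialIdem_mul_of_mul_partialIdem (ψ := ψ) (δ := δ) (w := w) d ▸ mul_mul_mem_idempotentCorner _ _

theorem sum_sum_sub {G M : Type*} [AddGroup G] [Fintype G] [AddCommMonoid M] (F : G → M) :
    ∑ s, ∑ q, F (q - s) = Fintype.card G • ∑ q, F q := by
  have h : ∀ s, ∑ q, F (q - s) = ∑ q, F q := fun s => Equiv.sum_comp (Equiv.subRight s) F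
  simp only [h, Finset.sum_const, Finset.card_univ]

theorem partialIdem_univ_eq_average (hm : (m : k) ≠ 0) :
    partialIdem ψ δ w Finset.univ = average ψ δ w (idDiagram m n) := by
  rw [average, partialIdem]
  -- The relabelled identity diagram depends only on the differences of the values of the gauge at
  -- the northern and the southern nodes.
  let F : (Fin n → ZMod m) → CyclotomicBrauer k m n δ := fun q =>
    ψ (∑ i, w i * q i) • of (ofLabels q)
  have h1 : ∀ g : CBNode n → ZMod m, ψ (pairing w g) •
      (of ((idDiagram m n).relabel g) : CyclotomicBrauer k m n δ) =
      F ((fun i => g (Sum.inl i)) - fun i => g (Sum.inr i)) := by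
    intro g
    simp only [F, ← relabel_idDiagram_northern]
    congr 2
    · simp [pairing, nodeWeight, mul_sub, Finset.sum_sub_distrib, sub_eq_add_neg, mul_add,
        Finset.sum_add_distrib]
    · ext v
      · rfl
      · rcases v with v | v <;> simp [relabel, idDiagram, ofLabels, sub_eq_add_neg,
          add_comm]
  have h2 : ∑ g : CBNode n → ZMod m, F ((fun i => g (Sum.inl i)) - fun i => g (Sum.inr i)) =
      m ^ n • ∑ q, F q := by
    rw [sum_eq_sum_elim, Finset.sum_comm]
    have h := sum_sum_sub F
    rw [Fintype.card_fun, ZMod.card, Fintype.card_fin] at h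
    exact h
  simp only [h1, h2, Finset.mem_univ, if_true]
  rw [← Nat.cast_smul_eq_nsmul k, smul_smul, Nat.cast_pow, pow_add, mul_inv, mul_assoc,
    inv_mul_cancel₀ (pow_ne_zero _ hm), mul_one]

theorem linearIndependent_average (hm : (m : k) ≠ 0) {I : Type*}
    (Z : I → CBDiagram m n) (hZ : ∀ i j, (Z i).partner = (Z j).partner → i = j)
    (hbal : ∀ i, (Z i).IsBalanced w) :
    LinearIndependent k fun i => (average ψ δ w (Z i) : CyclotomicBrauer k m n δ) := by
  classical
  -- A linear map which takes the average of `Z i` to the basis vector `i`.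
  let F : CyclotomicBrauer k m n δ →ₗ[k] I →₀ k := (basis k m n δ).constr k fun d =>
    if h : ∃ p : I × (CBNode n → ZMod m), (Z p.1).relabel p.2 = d then
      Finsupp.single h.choose.1 (ψ (-pairing w h.choose.2)) else 0
  have hF : ∀ i g, F (of ((Z i).relabel g)) = Finsupp.single i (ψ (-pairing w g)) := by
    intro i g
    have h : ∃ p : I × (CBNode n → ZMod m), (Z p.1).relabel p.2 = (Z i).relabel g := ⟨(i, g), rfl⟩
    have h1 : F (of ((Z i).relabel g)) =
        Finsupp.single h.choose.1 (ψ (-pairing w h.choose.2)) := by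
      rw [← basis_apply, Module.Basis.constr_basis, dif_pos h]
    have h2 := h.choose_spec
    have h2' : ((Z h.choose.1).relabel h.choose.2).partner = ((Z i).relabel g).partner :=
      congrArg CBDiagram.partner h2
    have h3 : h.choose.1 = i := hZ _ _ h2'
    rw [h1]
    clear h1 h2'
    generalize h.choose = p at h2 h3 ⊢
    obtain ⟨j, g'⟩ := p
    simp only at h2 h3
    subst h3
    rw [pairing_eq_of_relabel_eq (hbal _) h2]
  refine LinearIndependent.of_comp F ?_
  have : (F ∘ fun i => average ψ δ w (Z i)) = fun i => Finsupp.single i (1 : k) := by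
    funext i
    simp only [Function.comp_apply, average, map_smul, map_sum, hF, Finsupp.smul_single,
      smul_eq_mul, ← AddChar.map_add_eq_mul, add_neg_cancel, AddChar.map_zero_eq_one]
    simp [ZMod.card, hm]
  rw [this]
  exact Finsupp.linearIndependent_single_one k I

/-- The averages of a set of representatives of the balanced diagrams, up to the labels, are a basis
of the idempotent subalgebra. -/
theorem exists_basis_corner (hm : (m : k) ≠ 0) (hψ : ∀ a, ψ a = 1 → a = 0) {I : Type*}
    (Z : I → CBDiagram m n) (hZ : ∀ i j, (Z i).partner = (Z j).partner → i = j)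
    (hbal : ∀ i, (Z i).IsBalanced w)
    (hsurj : ∀ d : CBDiagram m n, d.IsBalanced w → ∃ i, d.partner = (Z i).partner) :
    ∃ b : Module.Basis I k (idempotentCorner k (partialIdem ψ δ w Finset.univ)),
      ∀ i, (b i : CyclotomicBrauer k m n δ) = average ψ δ w (Z i) := by
  have hli : LinearIndependent k fun i => (average ψ δ w (Z i) : CyclotomicBrauer k m n δ) :=
    linearIndependent_average hm Z hZ hbal
  have hspan : Submodule.span k (Set.range fun i => (average ψ δ w (Z i) :
      CyclotomicBrauer k m n δ)) = idempotentCorner k (partialIdem ψ δ w Finset.univ) := by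
    refine le_antisymm (Submodule.span_le.2 ?_) ?_
    · rintro _ ⟨i, rfl⟩
      exact average_mem_idempotentCorner _
    · rw [idempotentCorner_eq_span (basis k m n δ), Submodule.span_le]
      rintro _ ⟨d, rfl⟩
      simp only [SetLike.mem_coe, basis_apply, partialIdem_mul_of_mul_partialIdem]
      by_cases hd : d.IsBalanced w
      · obtain ⟨i, hi⟩ := hsurj d hd
        obtain ⟨g, rfl⟩ := exists_relabel_eq hi
        rw [average_relabel]
        exact Submodule.smul_mem _ _ (Submodule.subset_span ⟨i, rfl⟩)
      · rw [average_eq_zero hψ hd]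
        exact zero_mem _
  rw [← hspan]
  exact ⟨Module.Basis.span hli, fun i => congrArg Subtype.val (Module.Basis.span_apply hli i)⟩

end CyclotomicBrauer

/-! ### Diagrams that are assembled from blocks -/

namespace CBDiagram

open CBPoint

variable {n : ℕ} {C : Type*} {N : C → ℕ}

/-- The node of the whole diagram that corresponds to a node of a block. -/
def joinNode (e : (Σ c, Fin (N c)) ≃ Fin n) (c : C) : CBNode (N c) → CBNode n :=
  Sum.map (fun i => e ⟨c, i⟩) fun i => e ⟨c, i⟩

/-- The block of a node, and the corresponding node of the block. -/
def splitNode (e : (Σ c, Fin (N c)) ≃ Fin n) : CBNode n → Σ c, CBNode (N c) :=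
  Sum.elim (fun i => ⟨(e.symm i).1, Sum.inl (e.symm i).2⟩)
    fun i => ⟨(e.symm i).1, Sum.inr (e.symm i).2⟩

/-- The point of the concatenation of whole diagrams that corresponds to a point of the
concatenation of blocks. -/
def joinPoint (e : (Σ c, Fin (N c)) ≃ Fin n) (c : C) : CBPoint (N c) → CBPoint n :=
  Sum.map (joinNode e c) (joinNode e c)

variable (e : (Σ c, Fin (N c)) ≃ Fin n)

theorem splitNode_joinNode (c : C) (v : CBNode (N c)) :
    splitNode e (joinNode e c v) = ⟨c, v⟩ := by
  rcases v with i | i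
  · change (⟨(e.symm (e ⟨c, i⟩)).1, Sum.inl (e.symm (e ⟨c, i⟩)).2⟩ : Σ c, CBNode (N c)) = _
    rw [e.symm_apply_apply]
  · change (⟨(e.symm (e ⟨c, i⟩)).1, Sum.inr (e.symm (e ⟨c, i⟩)).2⟩ : Σ c, CBNode (N c)) = _
    rw [e.symm_apply_apply]

theorem exists_joinNode_eq (v : CBNode n) : ∃ c u, joinNode e c u = v := by
  rcases v with i | i
  · exact ⟨(e.symm i).1, Sum.inl (e.symm i).2, congrArg Sum.inl (e.apply_symm_apply i)⟩
  · exact ⟨(e.symm i).1, Sum.inr (e.symm i).2, congrArg Sum.inr (e.apply_symm_apply i)⟩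

theorem joinNode_injective (c : C) : Function.Injective (joinNode e c) := by
  intro u v h
  have := congrArg (splitNode e) h
  rw [splitNode_joinNode, splitNode_joinNode] at this
  exact eq_of_heq (Sigma.mk.inj this).2

theorem joinPoint_injective (c : C) : Function.Injective (joinPoint e c) :=
  Sum.map_injective.2 ⟨joinNode_injective e c, joinNode_injective e c⟩

theorem joinNode_splitNode (v : CBNode n) :
    joinNode e (splitNode e v).1 (splitNode e v).2 = v := by
  obtain ⟨c, u, rfl⟩ := exists_joinNode_eq e v
  rw [splitNode_joinNode]

/-- The diagram without labels whose strands are the strands of the blocks `x c`. -/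
def assemble (m : ℕ) {l : ℕ} (x : ∀ c, CBDiagram l (N c)) : CBDiagram m n where
  partner v := joinNode e (splitNode e v).1 ((x (splitNode e v).1).partner (splitNode e v).2)
  label _ := 0
  partner_partner v := by
    rw [splitNode_joinNode, partner_partner, joinNode_splitNode]
  partner_ne v h := by
    have h1 := congrArg (splitNode e) h
    rw [splitNode_joinNode] at h1
    generalize splitNode e v = s at h1
    exact (x s.1).partner_ne s.2 (eq_of_heq (Sigma.mk.inj h1).2)
  label_partner _ := neg_zero.symm

variable {m l : ℕ} (x y : ∀ c, CBDiagram l (N c))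

theorem assemble_partner_joinNode (c : C) (v : CBNode (N c)) :
    (assemble e m x).partner (joinNode e c v) = joinNode e c ((x c).partner v) := by
  change joinNode e (splitNode e (joinNode e c v)).1 _ = _
  rw [splitNode_joinNode]

theorem partner_eq_of_assemble_partner_eq {x y : ∀ c, CBDiagram l (N c)}
    (h : (assemble e m x).partner = (assemble e m y).partner) (c : C) :
    (x c).partner = (y c).partner := by
  funext v
  have := congrFun h (joinNode e c v)
  rw [assemble_partner_joinNode, assemble_partner_joinNode] at this
  exact joinNode_injective e c this

theorem exists_assemble_partner_eq (d : CBDiagram m n)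
    (hd : ∀ c v c' v', d.partner (joinNode e c v) = joinNode e c' v' → c = c') :
    ∃ x : ∀ c, CBDiagram 1 (N c), d.partner = (assemble e m x).partner := by
  have h : ∀ c v, ∃ u, d.partner (joinNode e c v) = joinNode e c u := by
    intro c v
    obtain ⟨c', u, hu⟩ := exists_joinNode_eq e (d.partner (joinNode e c v))
    obtain rfl := hd c v c' u hu.symm
    exact ⟨u, hu.symm⟩
  choose f hf using h
  refine ⟨fun c =>
    { partner := f c
      label := 0
      partner_partner := fun v => joinNode_injective e c (by
        rw [← hf, ← hf, d.partner_partner])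
      partner_ne := fun v hv => d.partner_ne (joinNode e c v) (by rw [hf, hv])
      label_partner := fun _ => neg_zero.symm }, ?_⟩
  funext v
  obtain ⟨c, u, rfl⟩ := exists_joinNode_eq e v
  rw [assemble_partner_joinNode, hf]

theorem glue_joinPoint (c : C) (d : CBPoint (N c)) :
    CBPoint.glue (joinPoint e c d) = joinPoint e c (CBPoint.glue d) := by
  rcases d with (_ | _) | (_ | _) <;> rfl

theorem isOuter_joinPoint (c : C) (d : CBPoint (N c)) :
    IsOuter (joinPoint e c d) ↔ IsOuter d := by
  rw [IsOuter, glue_joinPoint, (joinPoint_injective e c).eq_iff]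
  rfl

theorem ofNode_joinNode (c : C) (v : CBNode (N c)) :
    ofNode (joinNode e c v) = joinPoint e c (ofNode v) := by
  rcases v with _ | _ <;> rfl

theorem iterate_step_joinPoint (c : C) (a : ℕ) (d : CBPoint (N c)) :
    (step (assemble e m x) (assemble e m y))^[a] (joinPoint e c d) =
      joinPoint e c ((step (x c) (y c))^[a] d) := by
  have h : Function.Semiconj (joinPoint e c) (step (x c) (y c))
      (step (assemble e m x) (assemble e m y)) := by
    intro d
    rw [step, step, ← glue_joinPoint]
    congr 1
    rcases d with d | d
    · exact congrArg Sum.inl (assemble_partner_joinNode e x c d).symm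
    · exact congrArg Sum.inr (assemble_partner_joinNode e y c d).symm
  exact ((h.iterate_right a) d).symm

theorem pathLength_assemble (c : C) (v : CBNode (N c)) :
    pathLength (assemble e m x) (assemble e m y) (joinNode e c v) =
      pathLength (x c) (y c) v := by
  refine pathLength_eq (pathLength_pos _ _ _) ?_ fun j h0 hj => ?_ <;>
    rw [ofNode_joinNode, iterate_step_joinPoint, isOuter_joinPoint]
  · exact isOuter_pathLength _ _ _
  · exact not_isOuter_of_lt h0 hj

theorem concat_assemble :
    (assemble e m x).concat (assemble e m y) = assemble e m fun c => (x c).concat (y c) := by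
  ext v
  · obtain ⟨c, u, rfl⟩ := exists_joinNode_eq e v
    rw [assemble_partner_joinNode]
    change pathEnd _ _ _ = joinNode e c (pathEnd (x c) (y c) u)
    rw [pathEnd, ofNode_joinNode, pathLength_assemble, iterate_step_joinPoint, ← ofNode_pathEnd,
      ← ofNode_joinNode, toNode_ofNode]
  · change pathLabel _ _ v = 0
    refine Finset.sum_eq_zero fun a _ => ?_
    generalize (step (assemble e m x) (assemble e m y))^[a] (ofNode v) = d
    rcases d with d | d <;> rfl

theorem index_joinPoint (c : C) (d : CBPoint (N c)) :
    index (joinPoint e c d) = e ⟨c, index d⟩ := by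
  rcases d with (_ | _) | (_ | _) <;> rfl

/-- If the nodes of each block keep their order, then the leftmost nodes of the closed loops of the
whole concatenation are those of the blocks. -/
theorem isLoopStart_assemble (he : ∀ c, StrictMono fun i => e ⟨c, i⟩) (c : C) (j : Fin (N c)) :
    IsLoopStart (assemble e m x) (assemble e m y) (e ⟨c, j⟩) ↔ IsLoopStart (x c) (y c) j := by
  have hj : central (e ⟨c, j⟩) = joinPoint e c (central j) := rfl
  have hiff : ∀ (d : CBPoint (N c)) (i : Fin (N c)),
      (joinPoint e c d = central (e ⟨c, i⟩) ∨ joinPoint e c d = CBPoint.glue (central (e ⟨c, i⟩)))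
      ↔ (d = central i ∨ d = CBPoint.glue (central i)) := by
    intro d i
    have hi : central (e ⟨c, i⟩) = joinPoint e c (central i) := rfl
    rw [hi, glue_joinPoint, (joinPoint_injective e c).eq_iff, (joinPoint_injective e c).eq_iff]
  simp only [IsLoopStart, hj, iterate_step_joinPoint, isOuter_joinPoint]
  refine and_congr_right fun _ => ⟨fun h a i hi => ?_, fun h a i hi => ?_⟩
  · exact (he c).le_iff_le.1 (h a _ ((hiff _ _).2 hi))
  · -- A point of the block `c` has an index in the block `c`.
    have h1 : i = e ⟨c, index ((step (x c) (y c))^[a] (central j))⟩ := by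
      rw [← index_joinPoint]
      rcases hi with hi | hi <;> rw [hi]
      · rfl
      · exact (index_glue (central i)).symm
    rw [h1] at hi ⊢
    exact (he c).monotone (h a _ ((hiff _ _).1 hi))

theorem assemble_idDiagram : assemble e m (fun c => idDiagram l (N c)) = idDiagram m n := by
  ext v
  · obtain ⟨c, u, rfl⟩ := exists_joinNode_eq e v
    rw [assemble_partner_joinNode]
    rcases u with _ | _ <;> rfl
  · rcases v with _ | _ <;> simp [assemble, idDiagram, ofLabels]

theorem nodeWeight_joinNode {w : Fin n → ZMod m} {u : ∀ c, Fin (N c) → ZMod m}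
    (hw : ∀ c i, w (e ⟨c, i⟩) = u c i) (c : C) (v : CBNode (N c)) :
    nodeWeight w (joinNode e c v) = nodeWeight (u c) v := by
  rcases v with i | i
  · exact hw c i
  · exact congrArg Neg.neg (hw c i)

theorem isBalanced_assemble {w : Fin n → ZMod m} {u : ∀ c, Fin (N c) → ZMod m}
    (hw : ∀ c i, w (e ⟨c, i⟩) = u c i) :
    (assemble e m x).IsBalanced w ↔ ∀ c, (x c).IsBalanced (u c) := by
  constructor
  · intro h c v
    have := h (joinNode e c v)
    rwa [assemble_partner_joinNode, nodeWeight_joinNode e hw, nodeWeight_joinNode e hw] at this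
  · intro h v
    obtain ⟨c, v, rfl⟩ := exists_joinNode_eq e v
    rw [assemble_partner_joinNode, nodeWeight_joinNode e hw, nodeWeight_joinNode e hw]
    exact h c v

/-- In the concatenation of diagrams that are balanced for weights in a two-element set `{r, -r}`,
with weight `r` at the nodes on the left of a wall only, the leftmost node of a closed loop is on
the left of the wall. -/
theorem IsLoopStart.weight_eq {w : Fin n → ZMod m} {x y : CBDiagram l n} {j : Fin n}
    (hj : IsLoopStart x y j) (hy : y.IsBalanced w) {r : ZMod m}
    (hr : ∀ i, w i = r ∨ w i = -r) (hmono : ∀ i i', i ≤ i' → w i' = r → w i = r) : w j = r := by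
  rcases hr j with h | h
  · exact h
  -- The strand of `y` at `j` returns to a central node, with the opposite weight.
  rcases hp : y.partner (Sum.inl j) with i | i
  · have h1 : (step x y)^[1] (central j) = CBPoint.glue (central i) := by
      simp [step, across, central, hp]
    have h2 := hj.2 1 i (Or.inr h1)
    refine hmono _ _ h2 ?_
    have h3 := hy (Sum.inl j)
    rw [hp] at h3
    simp only [nodeWeight, Sum.elim_inl] at h3
    rw [h3, h, neg_neg]
  · refine absurd ?_ (hj.1 1)
    simp [step, across, central, hp, IsOuter, CBPoint.glue]

end CBDiagram

/-! ### Algebras with a basis of diagrams -/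

section Monomial

/-- The algebra `A` has a basis which contains the unit element as the member `one`, such that the
product of the members `i` and `j` is the scalar `c i j` times the member `op i j`. -/
def HasMonomialBasis (k A : Type*) [CommRing k] [NonAssocSemiring A] [Module k A] {I : Type*}
    (op : I → I → I) (c : I → I → k) (one : I) : Prop :=
  ∃ b : Module.Basis I k A, b one = 1 ∧ ∀ i j, b i * b j = c i j • b (op i j)

variable {k : Type*} [CommRing k]

theorem HasMonomialBasis.tensor {A B I J : Type*} [NonAssocSemiring A] [NonAssocSemiring B]
    [Module k A] [Module k B] [IsScalarTower k A A] [SMulCommClass k A A] [IsScalarTower k B B]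
    [SMulCommClass k B B] {op : I → I → I} {c : I → I → k} {one : I} {op' : J → J → J}
    {c' : J → J → k} {one' : J} (hA : HasMonomialBasis k A op c one)
    (hB : HasMonomialBasis k B op' c' one') :
    HasMonomialBasis k (A ⊗[k] B) (fun p q : I × J => (op p.1 q.1, op' p.2 q.2))
      (fun p q => c p.1 q.1 * c' p.2 q.2) (one, one') := by
  obtain ⟨b, hb, hmul⟩ := hA
  obtain ⟨b', hb', hmul'⟩ := hB
  refine ⟨b.tensorProduct b', ?_, fun p q => ?_⟩
  · rw [Module.Basis.tensorProduct_apply, hb, hb']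
    rfl
  · rw [Module.Basis.tensorProduct_apply', Module.Basis.tensorProduct_apply',
      Module.Basis.tensorProduct_apply', Algebra.TensorProduct.tmul_mul_tmul, hmul, hmul',
      TensorProduct.smul_tmul_smul]

theorem HasMonomialBasis.familyTensor {ι : Type*} [Fintype ι] {A I : ι → Type*}
    [∀ i, NonAssocRing (A i)] [∀ i, Module k (A i)] [∀ i, SMulCommClass k (A i) (A i)]
    [∀ i, IsScalarTower k (A i) (A i)] {op : ∀ i, I i → I i → I i} {c : ∀ i, I i → I i → k}
    {one : ∀ i, I i} (h : ∀ i, HasMonomialBasis k (A i) (op i) (c i) (one i)) :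
    HasMonomialBasis k (FamilyTensor k A) (fun (p q : ∀ i, I i) i => op i (p i) (q i))
      (fun p q => ∏ i, c i (p i) (q i)) one := by
  choose b hb hmul using h
  let B : Module.Basis (∀ i, I i) k (FamilyTensor k A) := Basis.piTensorProduct b
  have hB : ∀ p, B p = PiTensorProduct.tprod k fun i => b i (p i) :=
    Basis.piTensorProduct_apply b
  refine ⟨B, ?_, fun p q => ?_⟩
  · rw [hB]
    simp only [hb]
    rfl
  · rw [hB, hB, hB]
    refine (PiTensorProduct.tprod_mul_tprod _ _).trans ?_
    refine Eq.trans ?_ ((PiTensorProduct.tprod k).map_smul_univ (fun i => c i (p i) (q i))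
      fun i => b i (op i (p i) (q i)))
    exact congrArg _ (funext fun i => hmul i (p i) (q i))

theorem CyclotomicBrauer.hasMonomialBasis (m n : ℕ) (δ : ZMod m → k) :
    HasMonomialBasis k (CyclotomicBrauer k m n δ) CBDiagram.concat (CBDiagram.loopFactor δ)
      (CBDiagram.idDiagram m n) :=
  ⟨basis k m n δ, rfl, of_mul_of⟩

/-- The walled Brauer diagrams are a basis of the walled Brauer algebra. -/
theorem WalledBrauerAlgebra.hasMonomialBasis (r s : ℕ) (δ : k) :
    HasMonomialBasis k (WalledBrauerAlgebra k r s δ)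
      (I := {d : CBDiagram 1 (r + s) // d.IsWalled})
      (fun x y => ⟨x.1.concat y.1, x.2.concat y.2⟩)
      (fun x y => CBDiagram.loopFactor (fun _ => δ) x.1 y.1)
      ⟨CBDiagram.idDiagram 1 (r + s), CBDiagram.IsWalled.idDiagram 1 r s⟩ := by
  let v : {d : CBDiagram 1 (r + s) // d.IsWalled} → BrauerAlgebra k (r + s) δ :=
    fun d => CyclotomicBrauer.of d.1
  have hli : LinearIndependent k v :=
    (CyclotomicBrauer.basis k 1 (r + s) fun _ => δ).linearIndependent.comp Subtype.val
      Subtype.val_injective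
  have hrange : Set.range v =
      {a | ∃ d : CBDiagram 1 (r + s), d.IsWalled ∧ a = CyclotomicBrauer.of d} := by
    ext a
    constructor
    · rintro ⟨d, rfl⟩
      exact ⟨d.1, d.2, rfl⟩
    · rintro ⟨d, hd, rfl⟩
      exact ⟨⟨d, hd⟩, rfl⟩
  have hspan : Submodule.span k (Set.range v) = (walledBrauerSubalgebra k r s δ).toSubmodule := by
    rw [hrange]
    rfl
  let b : Module.Basis _ k (WalledBrauerAlgebra k r s δ) :=
    (Module.Basis.span hli).map (LinearEquiv.ofEq _ _ hspan)
  have hb : ∀ d, (b d : BrauerAlgebra k (r + s) δ) = CyclotomicBrauer.of d.1 := fun d =>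
    congrArg Subtype.val (Module.Basis.span_apply hli d)
  refine ⟨b, Subtype.ext (hb _), fun x y => Subtype.ext ?_⟩
  change (b x : BrauerAlgebra k (r + s) δ) * (b y : BrauerAlgebra k (r + s) δ) =
    CBDiagram.loopFactor (fun _ => δ) x.1 y.1 • (b _ : BrauerAlgebra k (r + s) δ)
  rw [hb, hb, hb, CyclotomicBrauer.of_mul_of]

end Monomial

/-! ### The idempotent subalgebra of a decomposition into blocks -/

namespace CyclotomicBrauer

open CBDiagram

variable {k : Type*} [Field k] {m n : ℕ} [NeZero m] {δ : ZMod m → k} {ψ : AddChar (ZMod m) k}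
  {w : Fin n → ZMod m} {C : Type*} [Fintype C] {N : C → ℕ}

/-- If the nodes fall into blocks such that a balanced diagram never joins nodes of different
blocks, then the idempotent subalgebra has a basis indexed by the families of balanced diagrams on
the blocks. -/
theorem exists_basis_corner_of_blocks (hm : (m : k) ≠ 0) (hψ : ∀ a, ψ a = 1 → a = 0)
    (e : (Σ c, Fin (N c)) ≃ Fin n) (he : ∀ c, StrictMono fun i => e ⟨c, i⟩)
    (u : ∀ c, Fin (N c) → ZMod m) (hw : ∀ c i, w (e ⟨c, i⟩) = u c i)
    (hsep : ∀ c v c' v', nodeWeight (u c) v = -nodeWeight (u c') v' → c = c') (η : C → k)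
    (hη : ∀ c (x y : CBDiagram 1 (N c)), x.IsBalanced (u c) → y.IsBalanced (u c) →
      ∀ j, IsLoopStart x y j → charParameter ψ δ (u c j) = η c) :
    ∃ b : Module.Basis {x : ∀ c, CBDiagram 1 (N c) // ∀ c, (x c).IsBalanced (u c)} k
        (idempotentCorner k (partialIdem ψ δ w Finset.univ)),
      (∀ x, (∀ c, x.1 c = idDiagram 1 (N c)) →
        (b x : CyclotomicBrauer k m n δ) = partialIdem ψ δ w Finset.univ) ∧
      ∀ x y z, (∀ c, z.1 c = (x.1 c).concat (y.1 c)) →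
        (b x : CyclotomicBrauer k m n δ) * b y =
          (∏ c, loopFactor (fun _ => η c) (x.1 c) (y.1 c)) •
            (b z : CyclotomicBrauer k m n δ) := by
  classical
  obtain ⟨b, hb⟩ := exists_basis_corner (δ := δ) (w := w) hm hψ
    (fun x : {x : ∀ c, CBDiagram 1 (N c) // ∀ c, (x c).IsBalanced (u c)} => assemble e m x.1)
    (fun x y h => Subtype.ext (funext fun c => CBDiagram.ext
      (partner_eq_of_assemble_partner_eq e h c) (Subsingleton.elim _ _)))
    (fun x => (isBalanced_assemble e x.1 hw).2 x.2) (by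
      intro d hd
      obtain ⟨x, hx⟩ := exists_assemble_partner_eq e d (by
        intro c v c' v' h
        refine (hsep c' v' c v ?_).symm
        rw [← nodeWeight_joinNode e hw, ← h, hd, nodeWeight_joinNode e hw])
      refine ⟨⟨x, (isBalanced_assemble e x hw (m := m)).1 fun v => ?_⟩, hx⟩
      rw [← hx]
      exact hd v)
  refine ⟨b, fun x hx => ?_, fun x y z hz => ?_⟩
  · rw [hb, show x.1 = fun c => idDiagram 1 (N c) from funext hx, assemble_idDiagram,
      partialIdem_univ_eq_average hm]
  · rw [hb, hb, hb, average_mul_average hm ((isBalanced_assemble e x.1 hw).2 x.2)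
      ((isBalanced_assemble e y.1 hw).2 y.2) (fun _ => rfl) fun _ => rfl, concat_assemble,
      show z.1 = fun c => (x.1 c).concat (y.1 c) from funext hz]
    congr 1
    rw [← Equiv.prod_comp e, Fintype.prod_sigma]
    refine Finset.prod_congr rfl fun c _ => Finset.prod_congr rfl fun j _ => ?_
    simp only [isLoopStart_assemble e x.1 y.1 he]
    split_ifs with hj
    · rw [hw, hη c _ _ (x.2 c) (y.2 c) j hj]
    · rfl

end CyclotomicBrauer

/-! ### The blocks of a composition -/

section Blocks

open CBDiagram

/-- For the blocks `0` and `m / 2` every diagram is balanced. -/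
theorem isBalanced_of_forall_eq {l m n : ℕ} {w : Fin n → ZMod m} {a : ZMod m} (ha : a + a = 0)
    (hw : ∀ i, w i = a) (d : CBDiagram l n) : d.IsBalanced w := by
  have h : ∀ v, nodeWeight w v = a := by
    rintro (i | i)
    · exact hw i
    · exact (congrArg Neg.neg (hw i)).trans (neg_eq_of_add_eq_zero_left ha)
  intro v
  rw [h, h]
  exact (neg_eq_of_add_eq_zero_left ha).symm

theorem val_finSigmaFinEquiv {m : ℕ} (ω : Fin m → ℕ) (r : Fin m) (i : Fin (ω r)) :
    ((finSigmaFinEquiv ⟨r, i⟩ : Fin (∑ r, ω r)) : ℕ) = ∑ s ∈ Finset.Iio r, ω s + i := by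
  rw [finSigmaFinEquiv_apply]
  congr 1
  refine Finset.sum_bij (fun s _ => Fin.castLE r.2.le s) ?_ ?_ ?_ fun _ _ => rfl
  · intro s _
    exact Finset.mem_Iio.2 s.2
  · intro s _ t _ h
    exact Fin.castLE_injective _ h
  · intro s hs
    have hs' : s < r := Finset.mem_Iio.1 hs
    exact ⟨⟨s, hs'⟩, Finset.mem_univ _, rfl⟩

theorem sum_Iic_eq {m : ℕ} (ω : Fin m → ℕ) (r : Fin m) :
    ∑ s ∈ Finset.Iic r, ω s = ∑ s ∈ Finset.Iio r, ω s + ω r := by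
  rw [← Finset.Iio_insert, Finset.sum_insert Finset.notMem_Iio_self, add_comm]

theorem sum_Iic_le_sum_Iio {m : ℕ} (ω : Fin m → ℕ) {r s : Fin m} (h : r < s) :
    ∑ t ∈ Finset.Iic r, ω t ≤ ∑ t ∈ Finset.Iio s, ω t :=
  Finset.sum_le_sum_of_subset fun _ ht =>
    Finset.mem_Iio.2 (lt_of_le_of_lt (Finset.mem_Iic.1 ht) h)

theorem finSigmaFinEquiv_lt {m : ℕ} {ω : Fin m → ℕ} {r s : Fin m} (h : r < s) (i : Fin (ω r))
    (j : Fin (ω s)) :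
    (finSigmaFinEquiv ⟨r, i⟩ : Fin (∑ r, ω r)) < finSigmaFinEquiv ⟨s, j⟩ := by
  rw [Fin.lt_def, val_finSigmaFinEquiv, val_finSigmaFinEquiv]
  have h1 := sum_Iic_le_sum_Iio ω h
  have h2 := sum_Iic_eq ω r
  have := i.2
  omega

theorem finSigmaFinEquiv_lt_iff {m : ℕ} {ω : Fin m → ℕ} {r : Fin m} (i j : Fin (ω r)) :
    (finSigmaFinEquiv ⟨r, i⟩ : Fin (∑ r, ω r)) < finSigmaFinEquiv ⟨r, j⟩ ↔ i < j := by
  rw [Fin.lt_def, val_finSigmaFinEquiv, val_finSigmaFinEquiv, Nat.add_lt_add_iff_left, Fin.lt_def]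

theorem inBlock_finSigmaFinEquiv_iff {m : ℕ} (ω : Fin m → ℕ) (r : Fin m)
    (j : Fin (∑ r, ω r)) :
    CyclotomicBrauer.InBlock ω r j ↔ (finSigmaFinEquiv.symm j).1 = r := by
  obtain ⟨⟨s, i⟩, rfl⟩ := finSigmaFinEquiv.surjective j
  rw [Equiv.symm_apply_apply, CyclotomicBrauer.InBlock, val_finSigmaFinEquiv, sum_Iic_eq]
  have := i.2
  have h2 := sum_Iic_eq ω s
  have h3 := sum_Iic_eq ω r
  rcases lt_trichotomy s r with h | h | h
  · have := sum_Iic_le_sum_Iio ω h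
    simp only [h.ne, iff_false]
    omega
  · subst h
    simp only [iff_true]
    omega
  · have := sum_Iic_le_sum_Iio ω h
    simp only [h.ne', iff_false]
    omega

/-- The residues `r` such that the blocks `r` and `m - r` are different, one for each such pair of
blocks. -/
abbrev PairIndex (m : ℕ) : Type := {r : Fin m // 0 < (r : ℕ) ∧ 2 * (r : ℕ) < m}

/-- The residue `m / 2`, if `m` is even. -/
abbrev HalfIndex (m : ℕ) : Type := {r : Fin m // 2 * (r : ℕ) = m}

/-- The residues up to sign. -/
abbrev BlockClass (m : ℕ) : Type := Unit ⊕ PairIndex m ⊕ HalfIndex m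

theorem half_add_half {m : ℕ} (r : HalfIndex m) :
    ((r.1 : ℕ) : ZMod m) + ((r.1 : ℕ) : ZMod m) = 0 := by
  rw [← Nat.cast_add, ← two_mul, r.2, ZMod.natCast_self]

theorem pair_ne_neg {m : ℕ} (r : PairIndex m) : (((r.1 : ℕ) : ZMod m)) ≠ -((r.1 : ℕ) : ZMod m) := by
  intro h
  rw [eq_neg_iff_add_eq_zero, ← Nat.cast_add, ZMod.natCast_eq_zero_iff] at h
  have := Nat.le_of_dvd (by have := r.2.1; omega) h
  have := r.2.2
  omega

theorem isEmpty_halfIndex {m : ℕ} (h : Odd m) : IsEmpty (HalfIndex m) :=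
  ⟨fun r => by
    obtain ⟨a, ha⟩ := h
    have := r.2
    omega⟩

/-- The non-negative integer at most `m / 2` that represents a residue up to sign. -/
def classResidue {m : ℕ} : BlockClass m → ℕ
  | Sum.inl _ => 0
  | Sum.inr (Sum.inl r) => r.1
  | Sum.inr (Sum.inr r) => r.1

theorem two_mul_classResidue_le {m : ℕ} (c : BlockClass m) : 2 * classResidue c ≤ m := by
  rcases c with c | r | r
  · exact Nat.zero_le _
  · exact r.2.2.le
  · exact r.2.le

variable {m : ℕ} [NeZero m]

/-- The residue `m - r`. -/
def PairIndex.neg (r : PairIndex m) : Fin m :=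
  ⟨m - (r.1 : ℕ), Nat.sub_lt (NeZero.pos m) r.2.1⟩

/-- The number of nodes in the blocks `r` and `-r`. -/
def classSize (ω : Fin m → ℕ) : BlockClass m → ℕ
  | Sum.inl _ => ω 0
  | Sum.inr (Sum.inl r) => ω r.1 + ω r.neg
  | Sum.inr (Sum.inr r) => ω r.1

/-- The block and the position in the block of a member of the union of the blocks `r` and `-r`. -/
def classPosition (ω : Fin m → ℕ) : (Σ c, Fin (classSize ω c)) → Σ r, Fin (ω r)
  | ⟨Sum.inl _, i⟩ => ⟨0, i⟩
  | ⟨Sum.inr (Sum.inl r), i⟩ =>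
    Fin.addCases (motive := fun _ => Σ r, Fin (ω r)) (fun j => ⟨r.1, j⟩) (fun j => ⟨r.neg, j⟩) i
  | ⟨Sum.inr (Sum.inr r), i⟩ => ⟨r.1, i⟩

theorem classPosition_pair_left (ω : Fin m → ℕ) (r : PairIndex m) (i : Fin (ω r.1)) :
    classPosition ω ⟨Sum.inr (Sum.inl r), Fin.castAdd _ i⟩ = ⟨r.1, i⟩ :=
  Fin.addCases_left (motive := fun _ => Σ r, Fin (ω r)) i

theorem classPosition_pair_right (ω : Fin m → ℕ) (r : PairIndex m) (i : Fin (ω r.neg)) :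
    classPosition ω ⟨Sum.inr (Sum.inl r), Fin.natAdd _ i⟩ = ⟨r.neg, i⟩ :=
  Fin.addCases_right (motive := fun _ => Σ r, Fin (ω r)) i

theorem exists_pair_position {ω : Fin m → ℕ} {r : PairIndex m}
    (i : Fin (classSize ω (Sum.inr (Sum.inl r)))) :
    (∃ j : Fin (ω r.1), i = Fin.castAdd (ω r.neg) j) ∨
      ∃ j : Fin (ω r.neg), i = Fin.natAdd (ω r.1) j := by
  change Fin (ω r.1 + ω r.neg) at i
  induction i using Fin.addCases with
  | left j => exact Or.inl ⟨j, rfl⟩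
  | right j => exact Or.inr ⟨j, rfl⟩

theorem classPosition_fst (ω : Fin m → ℕ) (c : BlockClass m) (i : Fin (classSize ω c)) :
    ((classPosition ω ⟨c, i⟩).1 : ℕ) = classResidue c ∨
      ((classPosition ω ⟨c, i⟩).1 : ℕ) = m - classResidue c := by
  rcases c with c | r | r
  · exact Or.inl (Fin.val_zero m)
  · rcases exists_pair_position i with ⟨j, rfl⟩ | ⟨j, rfl⟩
    · rw [classPosition_pair_left]
      exact Or.inl rfl
    · rw [classPosition_pair_right]
      exact Or.inr rfl
  · exact Or.inl rfl

theorem classResidue_injective : Function.Injective (classResidue (m := m)) := by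
  have hm := NeZero.pos m
  rintro (c | r | r) (d | s | s) h <;> simp only [classResidue] at h
  · rfl
  · have := s.2.1
    omega
  · have := s.2
    omega
  · have := r.2.1
    omega
  · rw [Subtype.ext (Fin.ext h)]
  · have := s.2
    have := r.2.2
    omega
  · have := r.2
    omega
  · have := r.2
    have := s.2.2
    omega
  · rw [Subtype.ext (Fin.ext h)]

theorem classPosition_injective (ω : Fin m → ℕ) : Function.Injective (classPosition ω) := by
  have hm := NeZero.pos m
  rintro ⟨c, i⟩ ⟨d, j⟩ h
  have hcd : c = d := by
    apply classResidue_injective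
    have h1 := classPosition_fst ω c i
    have h2 := classPosition_fst ω d j
    have h3 := two_mul_classResidue_le c
    have h4 := two_mul_classResidue_le d
    have h5 := (classPosition ω ⟨d, j⟩).1.2
    rw [h] at h1
    omega
  subst hcd
  congr 1
  rcases c with c | r | r
  · exact eq_of_heq (Sigma.mk.inj h).2
  · have hr := r.2
    rcases exists_pair_position i with ⟨i, rfl⟩ | ⟨i, rfl⟩ <;>
    rcases exists_pair_position j with ⟨j, rfl⟩ | ⟨j, rfl⟩
    · rw [classPosition_pair_left, classPosition_pair_left] at h
      rw [eq_of_heq (Sigma.mk.inj h).2]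
    · rw [classPosition_pair_left, classPosition_pair_right] at h
      have h1 : (r.1 : ℕ) = m - r.1 := congrArg (fun p => (p.1 : ℕ)) h
      omega
    · rw [classPosition_pair_left, classPosition_pair_right] at h
      have h1 : m - (r.1 : ℕ) = r.1 := congrArg (fun p => (p.1 : ℕ)) h
      omega
    · rw [classPosition_pair_right, classPosition_pair_right] at h
      rw [eq_of_heq (Sigma.mk.inj h).2]
  · exact eq_of_heq (Sigma.mk.inj h).2

theorem classPosition_surjective (ω : Fin m → ℕ) : Function.Surjective (classPosition ω) := by
  rintro ⟨r, i⟩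
  by_cases h0 : (r : ℕ) = 0
  · obtain rfl : r = 0 := Fin.ext h0
    exact ⟨⟨Sum.inl (), i⟩, rfl⟩
  rcases lt_trichotomy (2 * (r : ℕ)) m with h | h | h
  · exact ⟨_, classPosition_pair_left ω ⟨r, by omega, h⟩ i⟩
  · exact ⟨⟨Sum.inr (Sum.inr ⟨r, h⟩), i⟩, rfl⟩
  · have hr := r.2
    let s : PairIndex m := ⟨⟨m - r, by omega⟩, by simp only; omega, by simp only; omega⟩
    have hs : r = s.neg := Fin.ext (by simp only [PairIndex.neg, s]; omega)
    clear_value s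
    subst hs
    exact ⟨_, classPosition_pair_right ω s i⟩

/-- The decomposition of the nodes into the unions of the blocks `r` and `-r`. -/
noncomputable def classEquiv (ω : Fin m → ℕ) : (Σ c, Fin (classSize ω c)) ≃ Fin (∑ r, ω r) :=
  (Equiv.ofBijective (classPosition ω)
    ⟨classPosition_injective ω, classPosition_surjective ω⟩).trans finSigmaFinEquiv

theorem classEquiv_apply (ω : Fin m → ℕ) (p : Σ c, Fin (classSize ω c)) :
    classEquiv ω p = finSigmaFinEquiv (classPosition ω p) := rfl

theorem strictMono_classEquiv (ω : Fin m → ℕ) (c : BlockClass m) :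
    StrictMono fun i => classEquiv ω ⟨c, i⟩ := by
  intro i j h
  simp only [classEquiv_apply]
  rcases c with c | r | r
  · exact (finSigmaFinEquiv_lt_iff (r := 0) i j).2 h
  · have hr := r.2
    rcases exists_pair_position i with ⟨i, rfl⟩ | ⟨i, rfl⟩ <;>
    rcases exists_pair_position j with ⟨j, rfl⟩ | ⟨j, rfl⟩ <;>
    simp only [classPosition_pair_left, classPosition_pair_right]
    · exact (finSigmaFinEquiv_lt_iff i j).2 h
    · refine finSigmaFinEquiv_lt ?_ i j
      rw [Fin.lt_def]
      change (r.1 : ℕ) < m - r.1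
      omega
    · have h1 : ω r.1 + (i : ℕ) < j := h
      have := j.2
      omega
    · refine (finSigmaFinEquiv_lt_iff i j).2 ?_
      have h1 : ω r.1 + (i : ℕ) < ω r.1 + j := h
      exact Nat.lt_of_add_lt_add_left h1
  · exact (finSigmaFinEquiv_lt_iff (r := r.1) i j).2 h

/-- The block, as a residue modulo `m`, of a node. -/
noncomputable def classWeight (ω : Fin m → ℕ) (c : BlockClass m) (i : Fin (classSize ω c)) :
    ZMod m :=
  ((classPosition ω ⟨c, i⟩).1 : ℕ)

theorem classWeight_eq (ω : Fin m → ℕ) (c : BlockClass m) (i : Fin (classSize ω c)) :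
    classWeight ω c i = classResidue c ∨ classWeight ω c i = -classResidue c := by
  have h1 := two_mul_classResidue_le c
  rcases classPosition_fst ω c i with h | h <;> rw [classWeight, h]
  · exact Or.inl rfl
  · right
    rw [Nat.cast_sub (by omega), ZMod.natCast_self, zero_sub]

theorem eq_of_natCast_eq_or_neg {a b : ℕ} (ha : 2 * a ≤ m) (hb : 2 * b ≤ m)
    (h : (a : ZMod m) = b ∨ (a : ZMod m) = -b) : a = b := by
  have hm := NeZero.pos m
  rcases h with h | h
  · rw [ZMod.natCast_eq_natCast_iff'] at h
    rcases Nat.lt_or_ge a m with h1 | h1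
    · rcases Nat.lt_or_ge b m with h2 | h2
      · rwa [Nat.mod_eq_of_lt h1, Nat.mod_eq_of_lt h2] at h
      · omega
    · omega
  · rw [eq_neg_iff_add_eq_zero, ← Nat.cast_add, ZMod.natCast_eq_zero_iff] at h
    obtain ⟨c, hc⟩ := h
    rcases c with _ | _ | c
    · omega
    · omega
    · nlinarith

theorem nodeWeight_classWeight (ω : Fin m → ℕ) (c : BlockClass m)
    (v : CBNode (classSize ω c)) :
    nodeWeight (classWeight ω c) v = classResidue c ∨
      nodeWeight (classWeight ω c) v = -classResidue c := by
  rcases v with i | i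
  · exact classWeight_eq ω c i
  · rcases classWeight_eq ω c i with h | h
    · exact Or.inr (congrArg Neg.neg h)
    · exact Or.inl ((congrArg Neg.neg h).trans (neg_neg _))

/-- Nodes of opposite weight are in the same union of blocks. -/
theorem class_eq_of_nodeWeight_eq_neg (ω : Fin m → ℕ) (c : BlockClass m)
    (v : CBNode (classSize ω c)) (c' : BlockClass m) (v' : CBNode (classSize ω c'))
    (h : nodeWeight (classWeight ω c) v = -nodeWeight (classWeight ω c') v') : c = c' := by
  refine classResidue_injective (eq_of_natCast_eq_or_neg (two_mul_classResidue_le c)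
    (two_mul_classResidue_le c') ?_)
  rcases nodeWeight_classWeight ω c v with h1 | h1 <;>
  rcases nodeWeight_classWeight ω c' v' with h2 | h2 <;> rw [h1, h2] at h
  · exact Or.inr h
  · exact Or.inl (h.trans (neg_neg _))
  · exact Or.inl (neg_injective h)
  · exact Or.inr (by rw [← neg_neg (classResidue c : ZMod m), h, neg_neg])

theorem classWeight_pair (ω : Fin m → ℕ) (r : PairIndex m)
    (i : Fin (classSize ω (Sum.inr (Sum.inl r)))) :
    classWeight ω (Sum.inr (Sum.inl r)) i =
      if (i : ℕ) < ω r.1 then ((r.1 : ℕ) : ZMod m) else -((r.1 : ℕ) : ZMod m) := by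
  rcases exists_pair_position i with ⟨j, rfl⟩ | ⟨j, rfl⟩
  · have h : ((Fin.castAdd (ω r.neg) j : Fin (ω r.1 + ω r.neg)) : ℕ) < ω r.1 := j.2
    rw [if_pos h]
    exact congrArg (fun p : Σ r, Fin (ω r) => ((p.1 : ℕ) : ZMod m)) (classPosition_pair_left ω r j)
  · have h : ¬ ((Fin.natAdd (ω r.1) j : Fin (ω r.1 + ω r.neg)) : ℕ) < ω r.1 :=
      not_lt.2 (Nat.le_add_right (ω r.1) j)
    rw [if_neg h]
    refine (congrArg (fun p : Σ r, Fin (ω r) => ((p.1 : ℕ) : ZMod m))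
      (classPosition_pair_right ω r j)).trans ?_
    change ((m - r.1 : ℕ) : ZMod m) = _
    rw [Nat.cast_sub (by have := r.2.2; omega), ZMod.natCast_self, zero_sub]

/-- For the union of two different blocks `r` and `-r` the balanced diagrams are the walled
diagrams. -/
theorem isBalanced_iff_isWalled (ω : Fin m → ℕ) (r : PairIndex m)
    (d : CBDiagram 1 (ω r.1 + ω r.neg)) :
    d.IsBalanced (classWeight ω (Sum.inr (Sum.inl r))) ↔ d.IsWalled := by
  classical
  have h : ∀ v : CBNode (ω r.1 + ω r.neg),
      nodeWeight (classWeight ω (Sum.inr (Sum.inl r))) v =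
        if wallSide (ω r.1) v then ((r.1 : ℕ) : ZMod m) else -((r.1 : ℕ) : ZMod m) := by
    rintro (i | i)
    · refine (classWeight_pair ω r i).trans ?_
      by_cases hi : (i : ℕ) < ω r.1 <;> simp [wallSide, hi]
    · refine (congrArg Neg.neg (classWeight_pair ω r i)).trans ?_
      by_cases hi : (i : ℕ) < ω r.1 <;> simp [wallSide, hi]
  have hne := pair_ne_neg r
  rw [isWalled_iff]
  refine forall_congr' fun v : CBNode (ω r.1 + ω r.neg) => ?_
  have h1 := h (d.partner v)
  have h2 := h v
  rw [h1, h2]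
  by_cases hp : wallSide (ω r.1) (d.partner v) <;> by_cases hv : wallSide (ω r.1) v
  · rw [if_pos hp, if_pos hv]
    simp [hv, hp, hne]
  · rw [if_pos hp, if_neg hv]
    simp [hv, hp]
  · rw [if_neg hp, if_pos hv]
    simp [hv, hp]
  · rw [if_neg hp, if_neg hv]
    simp [hv, hp, hne.symm]

end Blocks

theorem signedParameter_eq_charParameter {k : Type*} [Field k] {m : ℕ} [NeZero m] {ξ : k}
    (hξ : ξ ^ m = 1) (δ : ZMod m → k) (r : ℕ) :
    signedParameter ξ δ r =
      CyclotomicBrauer.charParameter (AddChar.zmodChar m hξ) δ (r : ZMod m) := by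
  rw [signedParameter, CyclotomicBrauer.charParameter]
  congr 1
  refine Finset.sum_congr rfl fun i _ => ?_
  congr 1
  have h : (r : ZMod m) * i = ((i.val * r : ℕ) : ZMod m) := by
    rw [Nat.cast_mul, ZMod.natCast_zmod_val, mul_comm]
  rw [h, AddChar.zmodChar_apply']

/-! ### The isomorphism -/

section Isomorphism

open CBDiagram

variable {k : Type*} [Field k] {m : ℕ} [NeZero m]

theorem HasMonomialBasis.reindex {A I J : Type*} [NonAssocSemiring A] [Module k A]
    {op : I → I → I} {c : I → I → k} {one : I} (h : HasMonomialBasis k A op c one) (E : J ≃ I)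
    {op' : J → J → J} {c' : J → J → k} {one' : J} (hone : E one' = one)
    (hop : ∀ i j, E (op' i j) = op (E i) (E j)) (hc : ∀ i j, c' i j = c (E i) (E j)) :
    HasMonomialBasis k A op' c' one' := by
  obtain ⟨b, hb, hmul⟩ := h
  refine ⟨b.reindex E.symm, ?_, fun i j => ?_⟩
  · simp [hone, hb]
  · simp [hop, hc, hmul]

/-- The loop parameter of the union of the blocks `r` and `-r`. -/
noncomputable def classParameter (ξ : k) (δ : ZMod m → k) (c : BlockClass m) : k :=
  signedParameter ξ δ (classResidue c)

/-- Families of diagrams, a Brauer diagram for each of the blocks `0` and `m / 2` and a walled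
Brauer diagram for each pair of blocks `r` and `-r`. -/
abbrev DiagramFamily (ω : Fin m → ℕ) : Type :=
  (CBDiagram 1 (ω 0) × ∀ r : PairIndex m, {d : CBDiagram 1 (ω r.1 + ω r.neg) // d.IsWalled}) ×
    ∀ r : HalfIndex m, CBDiagram 1 (ω r.1)

namespace DiagramFamily

variable {ω : Fin m → ℕ}

/-- The family of identity diagrams. -/
noncomputable def one : DiagramFamily ω :=
  ((idDiagram 1 _, fun _ => ⟨idDiagram 1 _, IsWalled.idDiagram 1 _ _⟩), fun _ => idDiagram 1 _)

/-- The concatenation of two families. -/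
noncomputable def concat (x y : DiagramFamily ω) : DiagramFamily ω :=
  ((x.1.1.concat y.1.1, fun r => ⟨(x.1.2 r).1.concat (y.1.2 r).1, (x.1.2 r).2.concat (y.1.2 r).2⟩),
    fun r => (x.2 r).concat (y.2 r))

/-- The product of the loop factors of two families. -/
noncomputable def loopFactor (ξ : k) (δ : ZMod m → k) (x y : DiagramFamily ω) : k :=
  (CBDiagram.loopFactor (fun _ => signedParameter ξ δ 0) x.1.1 y.1.1 *
    ∏ r : PairIndex m,
      CBDiagram.loopFactor (fun _ => signedParameter ξ δ (r.1 : ℕ)) (x.1.2 r).1 (y.1.2 r).1) *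
    ∏ r : HalfIndex m,
      CBDiagram.loopFactor (fun _ => signedParameter ξ δ (r.1 : ℕ)) (x.2 r) (y.2 r)

/-- The members of a family. -/
def member (x : DiagramFamily ω) : ∀ c, CBDiagram 1 (classSize ω c)
  | Sum.inl _ => x.1.1
  | Sum.inr (Sum.inl r) => (x.1.2 r).1
  | Sum.inr (Sum.inr r) => x.2 r

theorem isBalanced_member (x : DiagramFamily ω) (c : BlockClass m) :
    (x.member c).IsBalanced (classWeight ω c) := by
  rcases c with c | r | r
  · exact isBalanced_of_forall_eq (a := 0) (zero_add 0)
      (fun _ => (congrArg Nat.cast (Fin.val_zero m)).trans Nat.cast_zero) _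
  · exact (isBalanced_iff_isWalled ω r _).2 (x.1.2 r).2
  · exact isBalanced_of_forall_eq (half_add_half r) (fun _ => rfl) _

/-- Families of balanced diagrams on the unions of the blocks `r` and `-r`. -/
def equivBalanced : DiagramFamily ω ≃
    {x : ∀ c, CBDiagram 1 (classSize ω c) // ∀ c, (x c).IsBalanced (classWeight ω c)} where
  toFun x := ⟨x.member, x.isBalanced_member⟩
  invFun x := ((x.1 (Sum.inl ()), fun r => ⟨x.1 (Sum.inr (Sum.inl r)),
    (isBalanced_iff_isWalled ω r _).1 (x.2 _)⟩), fun r => x.1 (Sum.inr (Sum.inr r)))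
  left_inv _ := rfl
  right_inv x := by
    refine Subtype.ext (funext fun c => ?_)
    rcases c with c | r | r <;> rfl

theorem member_one (c : BlockClass m) : (one : DiagramFamily ω).member c = idDiagram 1 _ := by
  rcases c with c | r | r <;> rfl

theorem member_concat (x y : DiagramFamily ω) (c : BlockClass m) :
    (x.concat y).member c = (x.member c).concat (y.member c) := by
  rcases c with c | r | r <;> rfl

theorem prod_loopFactor_member (ξ : k) (δ : ZMod m → k) (x y : DiagramFamily ω) :
    ∏ c, CBDiagram.loopFactor (fun _ => classParameter ξ δ c) (x.member c) (y.member c) =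
      loopFactor ξ δ x y := by
  rw [Fintype.prod_sum_type, Fintype.prod_sum_type, Fintype.prod_unique, ← mul_assoc]
  rfl

end DiagramFamily

theorem charParameter_of_isLoopStart {ξ : k} (hξ : ξ ^ m = 1) (δ : ZMod m → k) (ω : Fin m → ℕ)
    (c : BlockClass m) {x y : CBDiagram 1 (classSize ω c)} (hy : y.IsBalanced (classWeight ω c))
    {j : Fin (classSize ω c)} (hj : IsLoopStart x y j) :
    CyclotomicBrauer.charParameter (AddChar.zmodChar m hξ) δ (classWeight ω c j) =
      classParameter ξ δ c := by
  rw [classParameter, signedParameter_eq_charParameter hξ]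
  congr 1
  rcases c with c | r | r
  · exact congrArg Nat.cast (Fin.val_zero m)
  · refine hj.weight_eq hy (classWeight_eq ω _) fun i i' hi h => ?_
    rw [classWeight_pair] at h ⊢
    have h1 : (i' : ℕ) < ω r.1 := by
      by_contra h1
      rw [if_neg h1] at h
      exact pair_ne_neg r h.symm
    have h0 : (i : ℕ) < ω r.1 := lt_of_le_of_lt hi h1
    rw [if_pos h0]
    rfl
  · rfl

/-- An algebra with a basis of families of diagrams is isomorphic to the idempotent subalgebra. -/
theorem cornerIsomorphic_of_hasMonomialBasis (hm : (m : k) ≠ 0) {ξ : k}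
    (hξ : IsPrimitiveRoot ξ m) (δ : ZMod m → k) (ω : Fin m → ℕ) {B : Type*} [NonAssocSemiring B]
    [Module k B] [IsScalarTower k B B] [SMulCommClass k B B]
    (hB : HasMonomialBasis k B (DiagramFamily.concat (ω := ω)) (DiagramFamily.loopFactor ξ δ)
      DiagramFamily.one) :
    CornerIsomorphic k
      (CyclotomicBrauer.piIdem ξ δ ω : CyclotomicBrauer k m (∑ r, ω r) δ) B := by
  have hψ : ∀ a, AddChar.zmodChar m hξ.pow_eq_one a = 1 → a = 0 := by
    intro a ha
    rw [AddChar.zmodChar_apply] at ha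
    exact (ZMod.val_eq_zero a).1 (Nat.eq_zero_of_dvd_of_lt (hξ.dvd_of_pow_eq_one _ ha)
      (ZMod.val_lt a))
  rw [CyclotomicBrauer.piIdem_eq_partialIdem hm hξ.pow_eq_one
    (fun j => (finSigmaFinEquiv.symm j).1) (inBlock_finSigmaFinEquiv_iff ω)]
  obtain ⟨b, hb, hmul⟩ := CyclotomicBrauer.exists_basis_corner_of_blocks (δ := δ)
    (w := fun j => (((finSigmaFinEquiv.symm j).1 : ℕ) : ZMod m)) hm hψ (classEquiv ω)
    (strictMono_classEquiv ω) (classWeight ω)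
    (fun c i => by simp only [classEquiv_apply, Equiv.symm_apply_apply, classWeight])
    (class_eq_of_nodeWeight_eq_neg ω) (classParameter ξ δ)
    (fun c x y _ hy j hj => charParameter_of_isLoopStart hξ.pow_eq_one δ ω c hy hj)
  obtain ⟨b', hb', hmul'⟩ := hB
  refine cornerIsomorphic_of_basis (b.reindex DiagramFamily.equivBalanced.symm) b' _ _ _ ?_ hb'
    ?_ hmul'
  · rw [Module.Basis.reindex_apply]
    exact hb _ DiagramFamily.member_one
  · intro x y
    simp only [Module.Basis.reindex_apply, Equiv.symm_symm]
    rw [hmul (DiagramFamily.equivBalanced x) (DiagramFamily.equivBalanced y)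
      (DiagramFamily.equivBalanced (x.concat y)) (DiagramFamily.member_concat x y)]
    congr 1
    exact DiagramFamily.prod_loopFactor_member ξ δ x y

theorem hasMonomialBasis_walledBrauerTensor (ξ : k) (δ : ZMod m → k) (ω : Fin m → ℕ) :
    HasMonomialBasis k (WalledBrauerTensor ξ δ ω)
      (I := ∀ r : PairIndex m, {d : CBDiagram 1 (ω r.1 + ω r.neg) // d.IsWalled})
      (fun x y r => ⟨(x r).1.concat (y r).1, (x r).2.concat (y r).2⟩)
      (fun x y => ∏ r : PairIndex m,
        loopFactor (fun _ => signedParameter ξ δ (r.1 : ℕ)) (x r).1 (y r).1)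
      fun _ => ⟨idDiagram 1 _, IsWalled.idDiagram 1 _ _⟩ :=
  HasMonomialBasis.familyTensor (k := k)
    (A := fun r : PairIndex m =>
      WalledBrauerAlgebra k (ω r.1) (ω r.neg) (signedParameter ξ δ (r.1 : ℕ)))
    (I := fun r : PairIndex m => {d : CBDiagram 1 (ω r.1 + ω r.neg) // d.IsWalled})
    (op := fun _ x y => ⟨x.1.concat y.1, x.2.concat y.2⟩)
    (c := fun r x y => loopFactor (fun _ => signedParameter ξ δ (r.1 : ℕ)) x.1 y.1)
    (one := fun _ => ⟨idDiagram 1 _, IsWalled.idDiagram 1 _ _⟩)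
    fun r => WalledBrauerAlgebra.hasMonomialBasis (ω r.1) (ω r.neg)
      (signedParameter ξ δ (r.1 : ℕ))

/-- For even `m` there is exactly one residue `m / 2`. -/
@[reducible]
def uniqueHalfIndex (h : Even m) : Unique (HalfIndex m) where
  default := ⟨⟨m / 2, Nat.div_lt_self (NeZero.pos m) one_lt_two⟩, Nat.two_mul_div_two_of_even h⟩
  uniq r := Subtype.ext (Fin.ext (by
    have := r.2
    simp only
    omega))

end Isomorphism

theorem mainTheorem2 {k : Type*} [Field k] [IsAlgClosed k] {m : ℕ} [NeZero m]
    (hm : (m : k) ≠ 0) (ξ : k) (hξ : IsPrimitiveRoot ξ m) (δ : ZMod m → k)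
    (n : ℕ) (ω : Fin m → ℕ) (hω : ∑ r, ω r = n) :
    (Odd m →
      CornerIsomorphic k (CyclotomicBrauer.piIdem ξ δ ω : CyclotomicBrauer k m n δ)
        (BrauerAlgebra k (ω 0) (signedParameter ξ δ 0) ⊗[k] WalledBrauerTensor ξ δ ω)) ∧
    (Even m →
      CornerIsomorphic k (CyclotomicBrauer.piIdem ξ δ ω : CyclotomicBrauer k m n δ)
        ((BrauerAlgebra k (ω 0) (signedParameter ξ δ 0) ⊗[k] WalledBrauerTensor ξ δ ω) ⊗[k]
          BrauerAlgebra k (ω ⟨m / 2, Nat.div_lt_self (NeZero.pos m) one_lt_two⟩)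
            (signedParameter ξ δ (m / 2)))) := by
  subst hω
  have h2 := (CyclotomicBrauer.hasMonomialBasis 1 (ω 0) fun _ => signedParameter ξ δ 0).tensor
    (hasMonomialBasis_walledBrauerTensor ξ δ ω)
  refine ⟨fun h => ?_, fun h => ?_⟩
  · have := isEmpty_halfIndex h
    refine cornerIsomorphic_of_hasMonomialBasis hm hξ δ ω
      (h2.reindex (Equiv.prodUnique _ _) rfl (fun _ _ => rfl) fun x y => ?_)
    rw [DiagramFamily.loopFactor, Fintype.prod_empty (ι := HalfIndex m), mul_one]
    rfl
  · let _ := uniqueHalfIndex h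
    have h3 := h2.tensor (CyclotomicBrauer.hasMonomialBasis 1
      (ω ⟨m / 2, Nat.div_lt_self (NeZero.pos m) one_lt_two⟩) fun _ => signedParameter ξ δ (m / 2))
    refine cornerIsomorphic_of_hasMonomialBasis hm hξ δ ω
      (h3.reindex ((Equiv.refl _).prodCongr (Equiv.piUnique _)) rfl (fun _ _ => rfl)
        fun x y => ?_)
    rw [DiagramFamily.loopFactor, Fintype.prod_unique (ι := HalfIndex m)]
    rfl
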